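/- Notation. Functions are complex-valued on $\mathbb R$. For $f\in L^1(\mathbb R)$ put $\widehat f(v)=\frac1{\sqrt{2\pi}}\int_{\mathbb R}f(u)e^{-iuv}\,du$. For $\alpha>0$ let $W[|v|^\alpha;L^1(\mathbb R)]$ be the set of all $f\in L^1(\mathbb R)$ for which there is $g\in L^1(\mathbb R)$ with $|v|^\alpha\widehat f(v)=\widehat g(v)$ for all $v\in\mathbb R$. A function $f\in L^1(\mathbb R)$ has the strong Riesz derivative $D_s^{\alpha}f=g\in L^1(\mathbb R)$ if for some $j\in\mathbb N$ with $0<\alpha<2j$ $$\lim_{\varepsilon\to0+}\Bigl\|\frac1{C_{\alpha,2j}}\int_\varepsilon^\infty\frac{\overline\Delta_u^{2j}f(\cdot)}{u^{1+\alpha}}\,du-g(\cdot)\Bigr\|_{L^1(\mathbb R)}=0,$$ where $\overline\Delta_u^{2j}f(x)=\sum_{k=0}^{2j}(-1)^k\binom{2j}{k}f(x+(j-k)u)$ and $C_{\alpha,2j}=(-1)^j2^{2j-\alpha}\int_0^\infty\frac{\sin^{2j}u}{u^{1+\alpha}}\,du$. For $g\in L^1(\mathbb R)$, $r\in\mathbb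 N=\{1,2,\dots\}$ and $\delta>0$ let $\omega_r(g;\delta;L^1(\mathbb R))=\sup_{|t|\le\delta}\bigl\|\sum_{j=0}^r(-1)^{r-j}\binom rj g(\cdot+jt)\bigr\|_{L^1(\mathbb R)}$. For $\sigma>0$ let $R_\sigma(f)=-\sqrt{2\pi}\sum_{k\in\mathbb Z\setminus\{0\}}\widehat f(k\sigma)$. Theorem. Let $\alpha>1$ and let $f\in L^1(\mathbb R)$ be continuous. Then $f\in W[|v|^\alpha;L^1(\mathbb R)]$ if and only if $f$ possesses a strong Riesz derivative $D_s^\alpha f\in L^1(\mathbb R)$. In this case, for all $\sigma>0$ and $h=2\pi/\sigma$, the series $\sum_{k\in\mathbb Z}f(hk)$ and $\sum_{k\ne0}\widehat f(k\sigma)$ converge absolutely, $R_\sigma(f)$ is the remainder of the trapezoidal rule, $$\int_{-\infty}^\infty f(t)\,dt=h\sum_{k\in\mathbb Z}f(hk)+R_\sigma(f),$$ and for every $r\in\mathbb N$ $$|R_\sigma(f)|\le h^\alpha\,\frac{\zeta(\alpha)}{\pi^\alpha2^{r+\alpha-1}}\;\omega_r\!\left(D_s^\alpha f;\tfrac h2;L^1(\mathbb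 R)\right).$$ Furthermore, $$|R_\sigma(f)|\le h^\alpha\,\frac{\zeta(\alpha)}{\pi^\alpha2^{\alpha-1}}\;\|D_s^\alpha f\|_{L^1(\mathbb R)}.$$ -/

import Mathlib

open MeasureTheory Filter Topology

noncomputable section

namespace RieszQuadrature

/-- The Fourier transform `f̂(v) = (2π)^{-1/2} ∫ f(u) e^{-iuv} du` of `f ∈ L¹(ℝ)`. -/
def fourierT (f : ℝ → ℂ) (v : ℝ) : ℂ :=
  ((1 / Real.sqrt (2 * Real.pi) : ℝ) : ℂ) *
    ∫ u : ℝ, f u * Complex.exp (-(Complex.I * (u : ℂ) * (v : ℂ)))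

/-- The class `W[ψ(v); L¹(ℝ)]` of all `f ∈ L¹(ℝ)` such that `ψ f̂ = ĝ` for some `g ∈ L¹(ℝ)`. -/
def fourierClass (ψ : ℝ → ℂ) : Set (ℝ → ℂ) :=
  {f | Integrable f ∧ ∃ g : ℝ → ℂ, Integrable g ∧ ∀ v : ℝ, ψ v * fourierT f v = fourierT g v}

/-- The forward difference `(Δ_t^r f)(x) = ∑_{j=0}^r (-1)^{r-j} C(r,j) f(x + j t)`. -/
def forwardDiff (r : ℕ) (t : ℝ) (f : ℝ → ℂ) (x : ℝ) : ℂ :=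
  ∑ j ∈ Finset.range (r + 1), (-1 : ℂ) ^ (r - j) * (r.choose j : ℂ) * f (x + (j : ℝ) * t)

/-- The modulus of smoothness `ω_r(f; δ; L¹(ℝ)) = sup_{|t| ≤ δ} ‖Δ_t^r f‖_{L¹}`.
For `f ∈ L¹(ℝ)` the supremum is over a set bounded by `2^r ‖f‖_{L¹}`. -/
def modulus (r : ℕ) (f : ℝ → ℂ) (δ : ℝ) : ℝ :=
  sSup {y : ℝ | ∃ t : ℝ, |t| ≤ δ ∧ y = ∫ x : ℝ, ‖forwardDiff r t f x‖}

/-- The central difference `∑_{k=0}^{2j} (-1)^k C(2j,k) f(x + (j-k) u)` of order `2j`. -/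
def centralDiff (j : ℕ) (u : ℝ) (f : ℝ → ℂ) (x : ℝ) : ℂ :=
  ∑ k ∈ Finset.range (2 * j + 1),
    (-1 : ℂ) ^ k * ((2 * j).choose k : ℂ) * f (x + ((j : ℝ) - (k : ℝ)) * u)

/-- The constant `C_{α,2j} = (-1)^j 2^{2j-α} ∫_0^∞ sin^{2j}(u) / u^{1+α} du`. -/
def rieszConst (α : ℝ) (j : ℕ) : ℝ :=
  (-1 : ℝ) ^ j * (2 : ℝ) ^ (2 * (j : ℝ) - α) *
    ∫ u in Set.Ioi (0 : ℝ), Real.sin u ^ (2 * j) / u ^ (1 + α)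

/-- The truncated hypersingular integral
`(1 / C_{α,2j}) ∫_ε^∞ (central difference of order 2j of f at x) / u^{1+α} du`. -/
def truncRiesz (α : ℝ) (j : ℕ) (f : ℝ → ℂ) (ε x : ℝ) : ℂ :=
  ((1 / rieszConst α j : ℝ) : ℂ) *
    ∫ u in Set.Ioi ε, centralDiff j u f x / ((u ^ (1 + α) : ℝ) : ℂ)

/-- `g ∈ L¹(ℝ)` is the strong Riesz derivative `D_s^α f` of `f ∈ L¹(ℝ)`: for some integer `j` with
`0 < α < 2j`, the truncated integrals converge to `g` in `L¹`-norm as `ε → 0+`. -/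
def IsStrongRieszDeriv (α : ℝ) (f g : ℝ → ℂ) : Prop :=
  Integrable f ∧ Integrable g ∧ ∃ j : ℕ, 0 < α ∧ α < 2 * (j : ℝ) ∧
    Tendsto (fun ε : ℝ => eLpNorm (fun x => truncRiesz α j f ε x - g x) 1 volume)
      (𝓝[>] 0) (𝓝 0)

/-- The remainder `R_σ(f) = -√(2π) ∑_{k ∈ ℤ, k ≠ 0} f̂(kσ)`. -/
def remainder (σ : ℝ) (f : ℝ → ℂ) : ℂ :=
  -((Real.sqrt (2 * Real.pi) : ℝ) : ℂ) *
    ∑' k : {k : ℤ // k ≠ 0}, fourierT f (((k : ℤ) : ℝ) * σ)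

end RieszQuadrature

end

/-!
Write `ĝ = |v|^α f̂` for the relation that defines the class. The central difference of order `2j`
and step `u` has symbol `(-4)^j sin^{2j}(uv/2)`, so by Fubini the truncated hypersingular integral
of `f` is the Fourier multiplier `|v|^α λ(εv)`, where `λ(v)` is the normalised tail integral over
`(|v|/2, ∞)` of `sin^{2j} w / w^{1+α}` (`fourier_truncRiesz`). Since `λ(0) = 1` and `λ` is
continuous at `0`, letting `ε → 0` shows that a strong Riesz derivative `g` satisfies
`ĝ = |v|^α f̂` (`IsStrongRieszDeriv.fourier_eq`).

Conversely, the order `2j` may be chosen large. For `2j ≥ α + 3` the functions `λ`, `λ'` and `λ''`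
are integrable (for `λ = O(|v|^{-α})` this uses `α > 1`), hence `λ` is the
Fourier transform of a continuous kernel `q` with `q(x) = O(1/(1+x²))` and integral one (`exists_kernel_fourier_eq`). If `ĝ = |v|^α f̂`, the
truncated integral is the convolution of `g` with the dilate `q_ε`
(`truncRiesz_eq_convolution`), and it converges to `g` in `L¹` because the `q_ε` form an approximate
identity.

The same identity at `ε = 1` gives the decay needed for Poisson summation. The central term of the
difference contributes a multiple of `f(x)`, the others are convolutions of `f` with kernels
decaying like `|x|^{-1-α}`. So `f` is dominated by the convolution of `|f| + |g|` with `1/(1+x²)`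
(`exists_norm_le_cauchyMean`), and the samples `f(hk)` are absolutely summable. Poisson's formula
identifies the remainder of the trapezoidal rule with `R_σ(f)`.

Finally `|f̂(kσ)| = |kσ|^{-α} |ĝ(kσ)|` and `∑_{k ≠ 0} |k|^{-α} = 2ζ(α)`. The bound by the norm is
`|ĝ| ≤ ‖g‖₁ / √(2π)`; for the modulus of smoothness, the difference of order `r` with step
`t = h/(2k)` has the symbol `(e^{itv} - 1)^r = (-2)^r` at `v = kσ` (`norm_fourier_le_modulus`).

The lemmas use Mathlib's transform `𝓕`, normalised by `e^{-2πixξ}`, so that `v = 2πξ` and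
`|v|^α` appears as `(2π|ξ|)^α`; `fourierT_eq` relates it to `fourierT`.
-/

noncomputable section

namespace RieszQuadrature

open FourierTransform Set

/-! ### The kernel `sin^{2j} w / w^{1+α}` -/

/-- The function `sin^{2j} w / w^{1+α}`, meant for `w > 0`, whose integral over `(0, ∞)` enters
the normalising constant `C_{α,2j}`. -/
def sinKernel (α : ℝ) (j : ℕ) (w : ℝ) : ℝ := Real.sin w ^ (2 * j) / w ^ (1 + α)

lemma sinKernel_nonneg (α : ℝ) (j : ℕ) {w : ℝ} (hw : 0 ≤ w) : 0 ≤ sinKernel α j w :=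
  div_nonneg (by rw [pow_mul]; positivity) (by positivity)

lemma measurable_sinKernel (α : ℝ) (j : ℕ) : Measurable (sinKernel α j) := by
  unfold sinKernel; fun_prop

lemma sinKernel_le_rpow_of_pos (α : ℝ) (j : ℕ) {w : ℝ} (hw : 0 < w) :
    sinKernel α j w ≤ w ^ (2 * (j : ℝ) - 1 - α) := by
  have h : w ^ (2 * (j : ℝ) - 1 - α) = w ^ (2 * j) / w ^ (1 + α) := by
    rw [← Real.rpow_natCast, ← Real.rpow_sub hw]; push_cast; ring_nf
  rw [h, sinKernel]
  gcongr ?_ / _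
  rw [← (even_two_mul j).pow_abs, ← (even_two_mul j).pow_abs w]
  exact pow_le_pow_left₀ (abs_nonneg _) Real.abs_sin_le_abs _

lemma sinKernel_le_rpow_neg (α : ℝ) (j : ℕ) {w : ℝ} (hw : 0 < w) :
    sinKernel α j w ≤ w ^ (-(1 + α)) := by
  rw [Real.rpow_neg hw.le, sinKernel, div_eq_mul_inv]
  refine mul_le_of_le_one_left (by positivity) ?_
  rw [← (even_two_mul j).pow_abs]
  exact pow_le_one₀ (abs_nonneg _) (Real.abs_sin_le_one w)

lemma integrableOn_sinKernel {α : ℝ} {j : ℕ} (hα : 0 < α) (hj : α < 2 * (j : ℝ)) :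
    IntegrableOn (sinKernel α j) (Ioi 0) := by
  rw [← Ioc_union_Ioi_eq_Ioi zero_le_one]
  refine IntegrableOn.union ?_ ?_
  · have h : IntegrableOn (fun w : ℝ => w ^ (2 * (j : ℝ) - 1 - α)) (Ioc 0 1) := by
      rw [← intervalIntegrable_iff_integrableOn_Ioc_of_le zero_le_one]
      exact intervalIntegral.intervalIntegrable_rpow' (by linarith)
    refine Integrable.mono' h (measurable_sinKernel α j).aestronglyMeasurable ?_
    filter_upwards [ae_restrict_mem measurableSet_Ioc] with w hw
    rw [Real.norm_of_nonneg (sinKernel_nonneg α j hw.1.le)]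
    exact sinKernel_le_rpow_of_pos α j hw.1
  · have h : IntegrableOn (fun w : ℝ => w ^ (-(1 + α))) (Ioi 1) :=
      integrableOn_Ioi_rpow_of_lt (by linarith) one_pos
    refine Integrable.mono' h (measurable_sinKernel α j).aestronglyMeasurable ?_
    filter_upwards [ae_restrict_mem measurableSet_Ioi] with w hw
    have hw : (0 : ℝ) < w := one_pos.trans hw
    rw [Real.norm_of_nonneg (sinKernel_nonneg α j hw.le)]
    exact sinKernel_le_rpow_neg α j hw

/-- The tail integral of `sinKernel`; as a function of `|v|` it is, up to normalisation, the
Fourier multiplier of the truncated hypersingular integral. -/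
def sinKernelTail (α : ℝ) (j : ℕ) (v : ℝ) : ℝ := ∫ w in Ioi v, sinKernel α j w

lemma sinKernelTail_zero_pos {α : ℝ} {j : ℕ} (hα : 0 < α) (hj : α < 2 * (j : ℝ)) :
    0 < sinKernelTail α j 0 := by
  rw [sinKernelTail, setIntegral_pos_iff_support_of_nonneg_ae _ (integrableOn_sinKernel hα hj)]
  · have hsub : Ioo 0 Real.pi ⊆ Function.support (sinKernel α j) ∩ Ioi 0 := fun w hw =>
      ⟨(div_pos (pow_pos (Real.sin_pos_of_mem_Ioo hw) _) (Real.rpow_pos_of_pos hw.1 _)).ne', hw.1⟩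
    refine lt_of_lt_of_le ?_ (measure_mono hsub)
    simp [Real.volume_Ioo, Real.pi_pos]
  · filter_upwards [ae_restrict_mem measurableSet_Ioi] with w hw
    exact sinKernel_nonneg α j (le_of_lt hw)

lemma tendsto_sinKernelTail {α : ℝ} {j : ℕ} (hα : 0 < α) (hj : α < 2 * (j : ℝ)) :
    Tendsto (sinKernelTail α j) (𝓝[≥] 0) (𝓝 (sinKernelTail α j 0)) := by
  have h := (aecover_Ioi_of_Ioi (μ := volume) (l := 𝓝[≥] (0 : ℝ)) (a := fun v => v) (A := 0)
    (tendsto_id.mono_left nhdsWithin_le_nhds)).integral_tendsto_of_countably_generated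
    (integrableOn_sinKernel hα hj)
  refine h.congr' ?_
  filter_upwards [self_mem_nhdsWithin] with v hv
  rw [Measure.restrict_restrict measurableSet_Ioi, Ioi_inter_Ioi, sup_eq_left.2 hv, sinKernelTail]

lemma sinKernelTail_eq_sub {α : ℝ} {j : ℕ} (hα : 0 < α) (hj : α < 2 * (j : ℝ)) {v : ℝ}
    (hv : 0 ≤ v) :
    sinKernelTail α j v = sinKernelTail α j 0 - ∫ w in (0 : ℝ)..v, sinKernel α j w := by
  have h := integrableOn_sinKernel hα hj
  rw [sinKernelTail, sinKernelTail, ← Ioc_union_Ioi_eq_Ioi hv, setIntegral_union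
    (Ioc_disjoint_Ioi le_rfl) measurableSet_Ioi (h.mono_set Ioc_subset_Ioi_self)
    (h.mono_set (Ioi_subset_Ioi hv)), intervalIntegral.integral_of_le hv]
  ring

lemma sinKernelTail_nonneg (α : ℝ) (j : ℕ) {v : ℝ} (hv : 0 ≤ v) : 0 ≤ sinKernelTail α j v :=
  setIntegral_nonneg measurableSet_Ioi fun _ hw => sinKernel_nonneg α j (hv.trans (le_of_lt hw))

lemma sinKernelTail_le_zero {α : ℝ} {j : ℕ} (hα : 0 < α) (hj : α < 2 * (j : ℝ)) {v : ℝ}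
    (hv : 0 ≤ v) : sinKernelTail α j v ≤ sinKernelTail α j 0 := by
  rw [sinKernelTail_eq_sub hα hj hv, sub_le_self_iff]
  exact intervalIntegral.integral_nonneg hv fun w hw => sinKernel_nonneg α j hw.1

lemma sinKernelTail_le_rpow {α : ℝ} {j : ℕ} (hα : 0 < α) (hj : α < 2 * (j : ℝ)) {v : ℝ}
    (hv : 0 < v) : sinKernelTail α j v ≤ v ^ (-α) / α := by
  have h : ∫ w in Ioi v, w ^ (-(1 + α)) = v ^ (-α) / α := by
    rw [integral_Ioi_rpow_of_lt (by linarith) hv]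
    ring_nf
  rw [← h]
  refine setIntegral_mono_on ((integrableOn_sinKernel hα hj).mono_set (Ioi_subset_Ioi hv.le))
    (integrableOn_Ioi_rpow_of_lt (by linarith) hv) measurableSet_Ioi fun w hw =>
      sinKernel_le_rpow_neg α j (hv.trans hw)

/-! ### The multiplier is the Fourier transform of a rapidly decaying kernel -/

/-- Differentiability of an odd extension: away from the origin it is inherited from `φ`, at the
origin the quadratic bound forces derivative zero. -/
lemma hasDerivAt_sign_mul_abs {φ φ' : ℝ → ℝ} (hφ : ∀ x, 0 < x → HasDerivAt φ (φ' x) x)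
    (h0 : φ' 0 = 0) (hO : ∀ x, 0 < x → |φ x| ≤ x ^ 2 ) (x : ℝ) :
    HasDerivAt (fun x => Real.sign x * φ |x|) (φ' |x|) x := by
  rcases lt_trichotomy x 0 with hx | rfl | hx
  · rw [abs_of_neg hx]
    have h := ((hφ (-x) (neg_pos.2 hx)).comp x (hasDerivAt_neg x)).neg
    simp only [mul_neg, mul_one, neg_neg] at h
    refine h.congr_of_eventuallyEq ?_
    filter_upwards [gt_mem_nhds hx] with y hy
    simp [Real.sign_of_neg hy, abs_of_neg hy]
  · rw [abs_zero, h0, hasDerivAt_iff_isLittleO_nhds_zero]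
    have : (fun h : ℝ => h ^ 2) =o[𝓝 0] fun h : ℝ => h := by
      simpa using Asymptotics.isLittleO_pow_id (𝕜 := ℝ) one_lt_two
    refine Asymptotics.IsBigO.trans_isLittleO (.of_bound 1 (Eventually.of_forall fun y => ?_)) this
    rcases eq_or_ne y 0 with rfl | hy
    · simp
    · have h1 := hO |y| (abs_pos.2 hy)
      have h2 : |Real.sign y| = 1 := by
        rcases lt_or_gt_of_ne hy with h | h
        · simp [Real.sign_of_neg h]
        · simp [Real.sign_of_pos h]
      simpa [abs_mul, h2] using h1
  · rw [abs_of_pos hx]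
    refine (hφ x hx).congr_of_eventuallyEq ?_
    filter_upwards [lt_mem_nhds hx] with y hy
    simp [Real.sign_of_pos hy, abs_of_pos hy]

/-- The derivative of `sinKernel` on `(0, ∞)`. -/
def sinKernelDeriv (α : ℝ) (j : ℕ) (w : ℝ) : ℝ :=
  2 * j * Real.sin w ^ (2 * j - 1) * Real.cos w * w ^ (-(1 + α)) -
    (1 + α) * Real.sin w ^ (2 * j) * w ^ (-(1 + α) - 1)

lemma hasDerivAt_sinKernel (α : ℝ) (j : ℕ) {w : ℝ} (hw : 0 < w) :
    HasDerivAt (sinKernel α j) (sinKernelDeriv α j w) w := by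
  have h := ((Real.hasDerivAt_sin w).pow (2 * j)).mul
    (Real.hasDerivAt_rpow_const (p := -(1 + α)) (Or.inl hw.ne'))
  have h' : HasDerivAt (fun x => Real.sin x ^ (2 * j) * x ^ (-(1 + α)))
      (sinKernelDeriv α j w) w := by
    convert! h using 1
    rw [sinKernelDeriv]
    simp only [Pi.pow_apply]
    push_cast
    ring
  refine h'.congr_of_eventuallyEq ?_
  filter_upwards [lt_mem_nhds hw] with x hx
  rw [sinKernel, Real.rpow_neg (le_of_lt hx), div_eq_mul_inv]

lemma abs_sinKernelDeriv_le {α : ℝ} {j : ℕ} (hα : 1 < α) (hj : α + 3 ≤ 2 * (j : ℝ)) {w : ℝ}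
    (hw : 0 < w) : |sinKernelDeriv α j w| ≤ (2 * j + (1 + α)) * (2 * (1 + w ^ 2)⁻¹) := by
  have hj1 : 1 ≤ 2 * j := by
    have : (0 : ℝ) < j := by linarith
    have : 0 < j := by exact_mod_cast this
    omega
  -- Near `0` the exponents `2j - 2 - α` are nonnegative; for `w ≥ 1` the decay is at least `w⁻²`.
  have hs : |Real.sin w| ≤ min 1 w :=
    le_min (Real.abs_sin_le_one w) (Real.abs_sin_le_abs.trans_eq (abs_of_pos hw))
  have key : min 1 w ^ (2 * j - 1) * w ^ (-(1 + α)) ≤ 2 * (1 + w ^ 2)⁻¹ ∧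
      min 1 w ^ (2 * j) * w ^ (-(1 + α) - 1) ≤ 2 * (1 + w ^ 2)⁻¹ := by
    rcases le_total w 1 with h1 | h1
    · have hone : (1 : ℝ) ≤ 2 * (1 + w ^ 2)⁻¹ := by
        rw [← div_eq_mul_inv, one_le_div (by positivity)]
        nlinarith
      rw [min_eq_right h1]
      constructor
      · refine le_trans ?_ hone
        rw [← Real.rpow_natCast, ← Real.rpow_add hw, Nat.cast_sub hj1]
        refine Real.rpow_le_one hw.le h1 ?_
        push_cast
        linarith
      · refine le_trans ?_ hone
        rw [← Real.rpow_natCast, ← Real.rpow_add hw]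
        refine Real.rpow_le_one hw.le h1 ?_
        push_cast
        linarith
    · have hsq : w ^ (-2 : ℝ) ≤ 2 * (1 + w ^ 2)⁻¹ := by
        rw [Real.rpow_neg hw.le, Real.rpow_two, ← div_eq_mul_inv, inv_eq_one_div,
          div_le_div_iff₀ (by positivity) (by positivity)]
        nlinarith
      rw [min_eq_left h1, one_pow, one_pow, one_mul, one_mul]
      exact ⟨(Real.rpow_le_rpow_of_exponent_le h1 (by linarith)).trans hsq,
        (Real.rpow_le_rpow_of_exponent_le h1 (by linarith)).trans hsq⟩
  have h0 : 0 < min 1 w := lt_min one_pos hw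
  have hc := Real.abs_cos_le_one w
  rw [sinKernelDeriv]
  refine (norm_sub_le (_ : ℝ) _).trans ?_
  simp only [Real.norm_eq_abs]
  rw [add_mul (2 * (j : ℝ)) (1 + α) (2 * (1 + w ^ 2)⁻¹)]
  refine add_le_add ?_ ?_
  · rw [abs_mul, abs_mul, abs_mul, abs_pow, abs_of_nonneg (by positivity : (0 : ℝ) ≤ 2 * j),
      abs_of_pos (Real.rpow_pos_of_pos hw _)]
    calc 2 * j * |Real.sin w| ^ (2 * j - 1) * |Real.cos w| * w ^ (-(1 + α))
        ≤ 2 * j * (min 1 w) ^ (2 * j - 1) * 1 * w ^ (-(1 + α)) := by gcongr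
      _ = 2 * j * ((min 1 w) ^ (2 * j - 1) * w ^ (-(1 + α))) := by ring
      _ ≤ _ := mul_le_mul_of_nonneg_left key.1 (by positivity)
  · rw [abs_mul, abs_mul, abs_pow, abs_of_nonneg (by positivity : (0 : ℝ) ≤ 1 + α),
      abs_of_pos (Real.rpow_pos_of_pos hw _)]
    calc (1 + α) * |Real.sin w| ^ (2 * j) * w ^ (-(1 + α) - 1)
        ≤ (1 + α) * (min 1 w) ^ (2 * j) * w ^ (-(1 + α) - 1) := by gcongr
      _ = (1 + α) * ((min 1 w) ^ (2 * j) * w ^ (-(1 + α) - 1)) := by ring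
      _ ≤ _ := mul_le_mul_of_nonneg_left key.2 (by positivity)

/-- The odd extension of `sinKernel` to the real line. -/
def oddSinKernel (α : ℝ) (j : ℕ) (w : ℝ) : ℝ := Real.sign w * sinKernel α j |w|

lemma hasDerivAt_oddSinKernel {α : ℝ} {j : ℕ} (hα : 1 < α) (hj : α + 3 ≤ 2 * (j : ℝ)) (w : ℝ) :
    HasDerivAt (oddSinKernel α j) (sinKernelDeriv α j |w|) w := by
  have hj1 : j ≠ 0 := by
    rintro rfl
    norm_num at hj
    linarith
  refine hasDerivAt_sign_mul_abs (fun x hx => hasDerivAt_sinKernel α j hx) ?_ (fun x hx => ?_) w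
  · simp [sinKernelDeriv, hj1, (show 2 * j - 1 ≠ 0 by omega)]
  · rw [abs_of_nonneg (sinKernel_nonneg α j hx.le), ← Real.rpow_two]
    rcases le_total x 1 with h1 | h1
    · exact (sinKernel_le_rpow_of_pos α j hx).trans
        (Real.rpow_le_rpow_of_exponent_ge hx h1 (by linarith))
    · exact (sinKernel_le_rpow_neg α j hx).trans
        (Real.rpow_le_rpow_of_exponent_le h1 (by linarith))

lemma continuous_oddSinKernel {α : ℝ} {j : ℕ} (hα : 1 < α) (hj : α + 3 ≤ 2 * (j : ℝ)) :
    Continuous (oddSinKernel α j) :=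
  continuous_iff_continuousAt.2 fun w => (hasDerivAt_oddSinKernel hα hj w).continuousAt

lemma integrable_oddSinKernel {α : ℝ} {j : ℕ} (hα : 1 < α) (hj : α + 3 ≤ 2 * (j : ℝ)) :
    Integrable (oddSinKernel α j) := by
  refine Integrable.mono' (integrable_inv_one_add_sq.const_mul 2)
    (continuous_oddSinKernel hα hj).aestronglyMeasurable (Eventually.of_forall fun w => ?_)
  rcases eq_or_ne w 0 with rfl | hw
  · simp [oddSinKernel]
  have hw' : 0 < |w| := abs_pos.2 hw
  have h2 : |Real.sign w| = 1 := by
    rcases lt_or_gt_of_ne hw with h | h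
    · simp [Real.sign_of_neg h]
    · simp [Real.sign_of_pos h]
  rw [oddSinKernel, norm_mul, Real.norm_eq_abs, h2, one_mul,
    Real.norm_of_nonneg (sinKernel_nonneg α j hw'.le), ← sq_abs w]
  rcases le_total |w| 1 with h1 | h1
  · refine (sinKernel_le_rpow_of_pos α j hw').trans ?_
    refine (Real.rpow_le_one hw'.le h1 (by linarith)).trans ?_
    rw [← div_eq_mul_inv, one_le_div (by positivity)]
    nlinarith
  · refine (sinKernel_le_rpow_neg α j hw').trans ?_
    refine (Real.rpow_le_rpow_of_exponent_le h1 (by linarith : -(1 + α) ≤ -2)).trans ?_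
    rw [Real.rpow_neg hw'.le, Real.rpow_two, ← div_eq_mul_inv, inv_eq_one_div,
      div_le_div_iff₀ (by positivity) (by positivity)]
    nlinarith

lemma integrable_deriv_oddSinKernel {α : ℝ} {j : ℕ} (hα : 1 < α) (hj : α + 3 ≤ 2 * (j : ℝ)) :
    Integrable (fun w => sinKernelDeriv α j |w|) := by
  have hm : Measurable fun w => sinKernelDeriv α j |w| := by
    unfold sinKernelDeriv; fun_prop
  refine Integrable.mono' ((integrable_inv_one_add_sq.const_mul 2).const_mul (2 * j + (1 + α)))
    hm.aestronglyMeasurable ?_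
  filter_upwards [compl_mem_ae_iff.2 (measure_singleton (0 : ℝ))] with w hw
  have h := abs_sinKernelDeriv_le hα hj (abs_pos.2 (show w ≠ 0 from hw))
  rwa [sq_abs] at h

lemma sinKernelTail_abs_eq {α : ℝ} {j : ℕ} (hα : 0 < α) (hj : α < 2 * (j : ℝ)) (v : ℝ) :
    sinKernelTail α j |v| = sinKernelTail α j 0 - ∫ w in (0 : ℝ)..v, oddSinKernel α j w := by
  have hpos : ∀ v : ℝ, 0 ≤ v → sinKernelTail α j v =
      sinKernelTail α j 0 - ∫ w in (0 : ℝ)..v, oddSinKernel α j w := fun v hv => by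
    rw [sinKernelTail_eq_sub hα hj hv]
    congr 1
    refine intervalIntegral.integral_congr_ae (Eventually.of_forall fun w hw => ?_)
    rw [uIoc_of_le hv] at hw
    simp [oddSinKernel, Real.sign_of_pos hw.1, abs_of_pos hw.1]
  rcases le_total 0 v with hv | hv
  · rw [abs_of_nonneg hv, hpos v hv]
  · rw [abs_of_nonpos hv, hpos (-v) (neg_nonneg.2 hv)]
    have h := intervalIntegral.integral_comp_neg (a := v) (b := 0) (oddSinKernel α j)
    simp only [neg_zero] at h
    rw [← h, intervalIntegral.integral_symm]
    simp only [oddSinKernel, Real.sign_neg, abs_neg, neg_mul, intervalIntegral.integral_neg,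
      neg_neg]

lemma integrable_of_norm_le_of_norm_le_rpow {E : Type*} [NormedAddCommGroup E] {φ : ℝ → E}
    (hφ : Continuous φ) {α A B : ℝ} (hα : 1 < α) (hB : 0 ≤ B) (h0 : ∀ x, ‖φ x‖ ≤ A)
    (h1 : ∀ x, 1 ≤ |x| → ‖φ x‖ ≤ B * |x| ^ (-α)) : Integrable φ := by
  have hA : 0 ≤ A := (norm_nonneg _).trans (h0 0)
  have hint : Integrable fun v : ℝ => (A + B) * 2 ^ α * (1 + ‖v‖) ^ (-α) :=
    (integrable_one_add_norm (by simpa using hα)).const_mul _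
  refine hint.mono' hφ.aestronglyMeasurable (Eventually.of_forall fun v => ?_)
  -- `((1 + |v|) / 2) ^ (-α)` dominates `1` for `|v| ≤ 1` and `|v| ^ (-α)` for `|v| ≥ 1`.
  have hpos : (0 : ℝ) < 1 + |v| := by positivity
  have heq : (A + B) * 2 ^ α * (1 + |v|) ^ (-α) = (A + B) * ((1 + |v|) / 2) ^ (-α) := by
    rw [Real.div_rpow hpos.le zero_le_two, Real.rpow_neg zero_le_two, div_inv_eq_mul]
    ring
  rw [Real.norm_eq_abs, heq]
  rcases le_total |v| 1 with hv | hv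
  · have h2 : (1 : ℝ) ≤ ((1 + |v|) / 2) ^ (-α) :=
      Real.one_le_rpow_of_pos_of_le_one_of_nonpos (by positivity) (by linarith) (by linarith)
    have h3 := h0 v
    nlinarith
  · have h2 : |v| ^ (-α) ≤ ((1 + |v|) / 2) ^ (-α) :=
      Real.rpow_le_rpow_of_nonpos (by positivity) (by linarith) (by linarith)
    have h3 : 0 ≤ ((1 + |v|) / 2) ^ (-α) := by positivity
    refine (h1 v hv).trans ((mul_le_mul_of_nonneg_left h2 hB).trans ?_)
    exact mul_le_mul_of_nonneg_right (by linarith) h3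

lemma integrable_sinKernelTail_abs {α : ℝ} {j : ℕ} (hα : 1 < α) (hj : α + 3 ≤ 2 * (j : ℝ)) :
    Integrable (fun v => sinKernelTail α j |v|) := by
  have h0 : (0 : ℝ) < α := by linarith
  have hj' : α < 2 * (j : ℝ) := by linarith
  have hc : Continuous fun v => sinKernelTail α j |v| := by
    simp_rw [sinKernelTail_abs_eq h0 hj']
    exact continuous_const.sub (intervalIntegral.continuous_primitive
      (fun a b => (integrable_oddSinKernel hα hj).intervalIntegrable) 0)
  have hn : ∀ v : ℝ, ‖sinKernelTail α j |v|‖ = sinKernelTail α j |v| := fun v =>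
    Real.norm_of_nonneg (sinKernelTail_nonneg α j (abs_nonneg v))
  refine integrable_of_norm_le_of_norm_le_rpow hc hα zero_le_one
    (fun v => (hn v).trans_le (sinKernelTail_le_zero h0 hj' (abs_nonneg v))) fun v hv => ?_
  rw [hn, one_mul]
  exact (sinKernelTail_le_rpow h0 hj' (by linarith)).trans (div_le_self (by positivity) hα.le)

lemma norm_fourier_le_integral (f : ℝ → ℂ) (ξ : ℝ) : ‖𝓕 f ξ‖ ≤ ∫ x, ‖f x‖ :=
  VectorFourier.norm_fourierIntegral_le_integral_norm _ _ _ _ _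

lemma continuous_fourier {f : ℝ → ℂ} (hf : Integrable f) : Continuous (𝓕 f) :=
  VectorFourier.fourierIntegral_continuous Real.continuous_fourierChar
    continuous_inner hf

/-- If `f`, `f'` and `f''` are integrable, the Fourier transform of `f` decays quadratically. -/
lemma norm_fourier_le_of_integrable_deriv {f f' f'' : ℝ → ℂ} (hf : Integrable f)
    (hf' : Integrable f') (hf'' : Integrable f'') (h1 : ∀ x, HasDerivAt f (f' x) x)
    (h2 : ∀ x, HasDerivAt f' (f'' x) x) (ξ : ℝ) :
    ‖𝓕 f ξ‖ ≤ ((∫ x, ‖f x‖) + ∫ x, ‖f'' x‖) * (1 + ξ ^ 2)⁻¹ := by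
  have e1 : deriv f = f' := funext fun x => (h1 x).deriv
  have e2 : deriv f' = f'' := funext fun x => (h2 x).deriv
  have d1 := congrFun (Real.fourier_deriv hf (fun x => (h1 x).differentiableAt) (e1 ▸ hf')) ξ
  have d2 := congrFun (Real.fourier_deriv hf' (fun x => (h2 x).differentiableAt) (e2 ▸ hf'')) ξ
  rw [e1] at d1
  rw [e2] at d2
  have hn : ‖𝓕 f'' ξ‖ = (2 * Real.pi) ^ 2 * ξ ^ 2 * ‖𝓕 f ξ‖ := by
    rw [d2, d1, norm_smul, norm_smul]
    have : ‖(2 * Real.pi * Complex.I * ξ : ℂ)‖ = 2 * Real.pi * |ξ| := by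
      simp [abs_of_pos Real.pi_pos]
    rw [this, ← sq_abs ξ]
    ring
  have b0 := norm_fourier_le_integral f ξ
  have b2 := norm_fourier_le_integral f'' ξ
  rw [← div_eq_mul_inv, le_div_iff₀ (by positivity)]
  have hpi : (1 : ℝ) ≤ (2 * Real.pi) ^ 2 := by nlinarith [Real.pi_gt_three]
  have h3 : ξ ^ 2 * ‖𝓕 f ξ‖ ≤ (2 * Real.pi) ^ 2 * (ξ ^ 2 * ‖𝓕 f ξ‖) :=
    le_mul_of_one_le_left (by positivity) hpi
  nlinarith

lemma integrable_of_norm_le_inv_one_add_sq {q : ℝ → ℂ} (hq : Continuous q) {K : ℝ}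
    (hK : ∀ x, ‖q x‖ ≤ K * (1 + x ^ 2)⁻¹) : Integrable q :=
  (integrable_inv_one_add_sq.const_mul K).mono' hq.aestronglyMeasurable (Eventually.of_forall hK)

/-- For differences of sufficiently high order, the multiplier of the truncated hypersingular
integral is the Fourier transform of a continuous kernel with quadratic decay: the multiplier and
its first two derivatives are integrable. -/
lemma exists_kernel_fourier_eq {α : ℝ} {j : ℕ} (hα : 1 < α) (hj : α + 3 ≤ 2 * (j : ℝ)) :
    ∃ (q : ℝ → ℂ) (K : ℝ), Continuous q ∧ (∀ x, ‖q x‖ ≤ K * (1 + x ^ 2)⁻¹) ∧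
      ∀ ξ, 𝓕 q ξ = ((sinKernelTail α j (Real.pi * |ξ|) / sinKernelTail α j 0 : ℝ) : ℂ) := by
  have h0 : (0 : ℝ) < α := by linarith
  have hj' : α < 2 * (j : ℝ) := by linarith
  set A := sinKernelTail α j 0 with hA
  -- The multiplier in the variable `ξ` and its first two derivatives.
  let m : ℝ → ℂ := fun ξ => ((sinKernelTail α j |Real.pi * ξ| / A : ℝ) : ℂ)
  let m' : ℝ → ℂ := fun ξ => ((-(oddSinKernel α j (Real.pi * ξ) * Real.pi) / A : ℝ) : ℂ)
  let m'' : ℝ → ℂ := fun ξ =>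
    ((-(sinKernelDeriv α j |Real.pi * ξ| * Real.pi * Real.pi) / A : ℝ) : ℂ)
  have hlin : ∀ ξ : ℝ, HasDerivAt (fun ξ : ℝ => Real.pi * ξ) Real.pi ξ := fun ξ => by
    simpa using (hasDerivAt_id ξ).const_mul Real.pi
  have hm1 : ∀ ξ, HasDerivAt m (m' ξ) ξ := fun ξ => by
    refine HasDerivAt.ofReal_comp (HasDerivAt.div_const ?_ A)
    simp_rw [sinKernelTail_abs_eq h0 hj']
    have hc := continuous_oddSinKernel hα hj
    have := (hc.integral_hasStrictDerivAt 0 (Real.pi * ξ)).hasDerivAt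
    exact (this.comp ξ (hlin ξ)).const_sub A
  have hm2 : ∀ ξ, HasDerivAt m' (m'' ξ) ξ := fun ξ => by
    refine HasDerivAt.ofReal_comp (HasDerivAt.div_const ?_ A)
    exact (((hasDerivAt_oddSinKernel hα hj (Real.pi * ξ)).comp ξ (hlin ξ)).mul_const _).neg
  have hpi := Real.pi_ne_zero
  have i0 : Integrable m :=
    (((integrable_sinKernelTail_abs hα hj).comp_mul_left' hpi).div_const A).ofReal
  have i1 : Integrable m' :=
    ((((integrable_oddSinKernel hα hj).comp_mul_left' hpi).mul_const _).neg.div_const A).ofReal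
  have i2 : Integrable m'' :=
    (((((integrable_deriv_oddSinKernel hα hj).comp_mul_left' hpi).mul_const _).mul_const
      _).neg.div_const A).ofReal
  have hmc : Continuous m := continuous_iff_continuousAt.2 fun ξ => (hm1 ξ).continuousAt
  have hdec := norm_fourier_le_of_integrable_deriv i0 i1 i2 hm1 hm2
  have hFc := continuous_fourier i0
  have hFi := integrable_of_norm_le_inv_one_add_sq hFc hdec
  refine ⟨𝓕⁻ m, (∫ x, ‖m x‖) + ∫ x, ‖m'' x‖, ?_, fun x => ?_, fun ξ => ?_⟩
  · have : 𝓕⁻ m = fun x => 𝓕 m (-x) := funext fun x => Real.fourierInv_eq_fourier_neg m x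
    rw [this]
    exact hFc.comp continuous_neg
  · rw [Real.fourierInv_eq_fourier_neg]
    simpa using hdec (-x)
  · rw [hmc.fourier_fourierInv_eq i0 hFi]
    simp only [m, abs_mul, abs_of_pos Real.pi_pos]

/-! ### Fourier transforms of differences and of truncated hypersingular integrals -/

lemma fourier_comp_add (f : ℝ → ℂ) (a ξ : ℝ) :
    𝓕 (fun x => f (x + a)) ξ = Complex.exp (2 * Real.pi * Complex.I * a * ξ) * 𝓕 f ξ := by
  rw [Real.fourier_real_eq_integral_exp_smul, Real.fourier_real_eq_integral_exp_smul,
    ← integral_const_mul, ← integral_add_right_eq_self (fun x : ℝ =>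
      Complex.exp (2 * Real.pi * Complex.I * a * ξ) *
        Complex.exp (((-2 * Real.pi * x * ξ : ℝ) : ℂ) * Complex.I) • f x) a]
  refine integral_congr_ae (Eventually.of_forall fun x => ?_)
  have h : Complex.exp (((-2 * Real.pi * x * ξ : ℝ) : ℂ) * Complex.I) =
      Complex.exp (2 * Real.pi * Complex.I * a * ξ) *
        Complex.exp (((-2 * Real.pi * (x + a) * ξ : ℝ) : ℂ) * Complex.I) := by
    rw [← Complex.exp_add]
    congr 1
    push_cast
    ring
  simp only [smul_eq_mul]
  rw [h, mul_assoc]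

lemma fourier_const_mul (c : ℂ) (f : ℝ → ℂ) (ξ : ℝ) :
    𝓕 (fun x => c * f x) ξ = c * 𝓕 f ξ := by
  rw [Real.fourier_real_eq_integral_exp_smul, Real.fourier_real_eq_integral_exp_smul,
    ← integral_const_mul]
  congr 1
  ext x
  simp only [smul_eq_mul]
  ring

lemma integrable_exp_mul {f : ℝ → ℂ} (hf : Integrable f) (ξ : ℝ) :
    Integrable fun x => Complex.exp (((-2 * Real.pi * x * ξ : ℝ) : ℂ) * Complex.I) * f x := by
  refine hf.bdd_mul (c := 1) (by fun_prop) (Eventually.of_forall fun x => ?_)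
  rw [Complex.norm_exp_ofReal_mul_I]

lemma fourier_finset_sum {ι : Type*} (s : Finset ι) {f : ι → ℝ → ℂ}
    (hf : ∀ i ∈ s, Integrable (f i)) (ξ : ℝ) :
    𝓕 (fun x => ∑ i ∈ s, f i x) ξ = ∑ i ∈ s, 𝓕 (f i) ξ := by
  simp_rw [Real.fourier_real_eq_integral_exp_smul, smul_eq_mul, Finset.mul_sum]
  exact integral_finsetSum s fun i hi => integrable_exp_mul (hf i hi) ξ

lemma integrable_forwardDiff {f : ℝ → ℂ} (hf : Integrable f) (r : ℕ) (t : ℝ) :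
    Integrable (forwardDiff r t f) :=
  integrable_finsetSum _ fun _ _ => (hf.comp_add_right _).const_mul _

lemma fourier_forwardDiff {f : ℝ → ℂ} (hf : Integrable f) (r : ℕ) (t ξ : ℝ) :
    𝓕 (forwardDiff r t f) ξ =
      (Complex.exp (2 * Real.pi * Complex.I * t * ξ) - 1) ^ r * 𝓕 f ξ := by
  have h := fourier_finset_sum (Finset.range (r + 1))
    (f := fun j x => (-1 : ℂ) ^ (r - j) * (r.choose j : ℂ) * f (x + (j : ℝ) * t))
    (fun j _ => (hf.comp_add_right _).const_mul _) ξ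
  change 𝓕 (fun x => ∑ j ∈ Finset.range (r + 1), (-1 : ℂ) ^ (r - j) * (r.choose j : ℂ) *
    f (x + (j : ℝ) * t)) ξ = _
  rw [h, sub_eq_add_neg, add_pow, Finset.sum_mul]
  refine Finset.sum_congr rfl fun j _ => ?_
  rw [fourier_const_mul, fourier_comp_add f, ← Complex.exp_nat_mul]
  push_cast
  ring_nf

/-- The symbol of the central difference of order `2j`. -/
lemma sum_centralDiff_symbol (j : ℕ) (θ : ℝ) :
    ∑ k ∈ Finset.range (2 * j + 1), (-1 : ℂ) ^ k * ((2 * j).choose k : ℂ) *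
      Complex.exp (((j : ℝ) - (k : ℝ) : ℝ) * (2 * θ) * Complex.I) =
      (((-4) ^ j * Real.sin θ ^ (2 * j) : ℝ) : ℂ) := by
  have h : (((-4) ^ j * Real.sin θ ^ (2 * j) : ℝ) : ℂ) =
      (-Complex.exp (-(θ * Complex.I)) + Complex.exp (θ * Complex.I)) ^ (2 * j) := by
    have : -Complex.exp (-(θ * Complex.I)) + Complex.exp (θ * Complex.I) =
        2 * Complex.I * Complex.sin θ := by
      rw [Complex.sin, neg_mul]
      linear_combination (Complex.exp (θ * Complex.I) - Complex.exp (-(θ * Complex.I))) *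
        Complex.I_sq
    rw [this, mul_pow, pow_mul (2 * Complex.I), mul_pow 2, Complex.I_sq]
    push_cast
    norm_num
  rw [h, add_pow]
  refine Finset.sum_congr rfl fun k hk => ?_
  have hk : k ≤ 2 * j := Nat.lt_succ_iff.1 (Finset.mem_range.1 hk)
  have e : Complex.exp (((j : ℝ) - (k : ℝ) : ℝ) * (2 * θ) * Complex.I) =
      Complex.exp (-(θ * Complex.I)) ^ k * Complex.exp (θ * Complex.I) ^ (2 * j - k) := by
    rw [← Complex.exp_nat_mul, ← Complex.exp_nat_mul, ← Complex.exp_add, Nat.cast_sub hk]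
    congr 1
    push_cast
    ring
  rw [e, neg_pow (Complex.exp _)]
  ring

lemma fourier_centralDiff {f : ℝ → ℂ} (hf : Integrable f) (j : ℕ) (u ξ : ℝ) :
    𝓕 (centralDiff j u f) ξ =
      (((-4) ^ j * Real.sin (Real.pi * ξ * u) ^ (2 * j) : ℝ) : ℂ) * 𝓕 f ξ := by
  have h := fourier_finset_sum (Finset.range (2 * j + 1))
    (f := fun k x => (-1 : ℂ) ^ k * ((2 * j).choose k : ℂ) * f (x + ((j : ℝ) - (k : ℝ)) * u))
    (fun k _ => (hf.comp_add_right _).const_mul _) ξ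
  change 𝓕 (fun x => ∑ k ∈ Finset.range (2 * j + 1),
    (-1 : ℂ) ^ k * ((2 * j).choose k : ℂ) * f (x + ((j : ℝ) - (k : ℝ)) * u)) ξ = _
  rw [h, ← sum_centralDiff_symbol, Finset.sum_mul]
  refine Finset.sum_congr rfl fun k _ => ?_
  rw [fourier_const_mul, fourier_comp_add f]
  push_cast
  ring_nf

lemma integrable_comp_add_mul_div_rpow {f : ℝ → ℂ} (hf : Integrable f) (hfc : Continuous f)
    {α ε : ℝ} (hα : 0 < α) (hε : 0 < ε) (m : ℝ) :
    Integrable (fun p : ℝ × ℝ => f (p.1 + m * p.2) / ((p.2 ^ (1 + α) : ℝ) : ℂ))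
      (volume.prod (volume.restrict (Ioi ε))) := by
  have hmeas : AEStronglyMeasurable
      (fun p : ℝ × ℝ => f (p.1 + m * p.2) / ((p.2 ^ (1 + α) : ℝ) : ℂ))
      (volume.prod (volume.restrict (Ioi ε))) := by
    have h1 : Measurable fun p : ℝ × ℝ => f (p.1 + m * p.2) := by
      have := hfc.measurable
      fun_prop
    have h2 : Measurable fun p : ℝ × ℝ => ((p.2 ^ (1 + α) : ℝ) : ℂ) := by fun_prop
    exact (h1.div h2).aestronglyMeasurable
  rw [integrable_prod_iff' hmeas]
  constructor
  · refine Eventually.of_forall fun u => ?_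
    have := (hf.comp_add_right (m * u)).div_const ((u ^ (1 + α) : ℝ) : ℂ)
    exact this
  have hpow : IntegrableOn (fun u : ℝ => u ^ (-(1 + α))) (Ioi ε) :=
    integrableOn_Ioi_rpow_of_lt (by linarith) hε
  refine (hpow.const_mul (∫ x, ‖f x‖)).congr ?_
  filter_upwards [ae_restrict_mem measurableSet_Ioi] with u hu
  have hu : (0 : ℝ) < u := hε.trans hu
  simp only [norm_div, Complex.norm_real, Real.norm_of_nonneg (Real.rpow_nonneg hu.le _)]
  rw [integral_div, integral_add_right_eq_self (fun x => ‖f x‖), Real.rpow_neg hu.le,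
    div_eq_mul_inv]

lemma centralDiff_div (j : ℕ) (u : ℝ) (f : ℝ → ℂ) (x : ℝ) (c : ℂ) :
    centralDiff j u f x / c = ∑ k ∈ Finset.range (2 * j + 1),
      (-1 : ℂ) ^ k * ((2 * j).choose k : ℂ) * (f (x + ((j : ℝ) - (k : ℝ)) * u) / c) := by
  rw [centralDiff, Finset.sum_div]
  simp_rw [mul_div_assoc]

lemma integrable_centralDiff_div_rpow {f : ℝ → ℂ} (hf : Integrable f) (hfc : Continuous f)
    {α ε : ℝ} (hα : 0 < α) (hε : 0 < ε) (j : ℕ) :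
    Integrable (fun p : ℝ × ℝ => centralDiff j p.2 f p.1 / ((p.2 ^ (1 + α) : ℝ) : ℂ))
      (volume.prod (volume.restrict (Ioi ε))) := by
  simp_rw [centralDiff_div]
  exact integrable_finsetSum _ fun k _ =>
    (integrable_comp_add_mul_div_rpow hf hfc hα hε _).const_mul _

lemma integrable_truncRiesz {f : ℝ → ℂ} (hf : Integrable f) (hfc : Continuous f)
    {α ε : ℝ} (hα : 0 < α) (hε : 0 < ε) (j : ℕ) : Integrable (truncRiesz α j f ε) :=
  (integrable_centralDiff_div_rpow hf hfc hα hε j).integral_prod_left.const_mul _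

lemma rieszConst_eq (α : ℝ) (j : ℕ) :
    rieszConst α j = (-4) ^ j * 2 ^ (-α) * sinKernelTail α j 0 := by
  rw [rieszConst, sinKernelTail]
  congr 1
  rw [sub_eq_add_neg, Real.rpow_add two_pos, Real.rpow_mul zero_le_two, Real.rpow_natCast,
    Real.rpow_two, neg_pow 4]
  norm_num
  ring

/-- Rescaling the variable of integration turns the symbol of the truncated hypersingular integral
into a multiple of `|ξ|^α`. -/
lemma integral_sin_pow_div_rpow {α : ℝ} (hα : 0 < α) {j : ℕ} (hj : j ≠ 0) {ε : ℝ} (hε : 0 < ε)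
    (ξ : ℝ) :
    ∫ u in Ioi ε, Real.sin (Real.pi * ξ * u) ^ (2 * j) / u ^ (1 + α) =
      (Real.pi * |ξ|) ^ α * sinKernelTail α j (Real.pi * |ξ| * ε) := by
  rcases eq_or_ne ξ 0 with rfl | hξ
  · simp [hj, Real.zero_rpow hα.ne']
  set b := Real.pi * |ξ| with hb
  have hb0 : 0 < b := by positivity
  have h := integral_comp_mul_left_Ioi (sinKernel α j) ε hb0
  rw [sinKernelTail]
  have h2 : ∫ w in Ioi (b * ε), sinKernel α j w = b * ∫ u in Ioi ε, sinKernel α j (b * u) := by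
    rw [h, smul_eq_mul, mul_inv_cancel_left₀ hb0.ne']
  rw [h2, ← mul_assoc, ← integral_const_mul]
  refine setIntegral_congr_fun measurableSet_Ioi fun u hu => ?_
  have hu : (0 : ℝ) < u := hε.trans hu
  have hsin : Real.sin (Real.pi * ξ * u) ^ (2 * j) = Real.sin (b * u) ^ (2 * j) := by
    rcases abs_choice ξ with h | h
    · rw [hb, h]
    · rw [hb, h, mul_neg, neg_mul, Real.sin_neg, (even_two_mul j).neg_pow]
  simp only [sinKernel]
  rw [hsin, Real.mul_rpow hb0.le hu.le, Real.rpow_add hb0, Real.rpow_one]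
  field_simp

/-- The truncated hypersingular integral is a Fourier multiplier. -/
lemma fourier_truncRiesz {f : ℝ → ℂ} (hf : Integrable f) (hfc : Continuous f)
    {α ε : ℝ} (hα : 0 < α) (hε : 0 < ε) {j : ℕ} (hj : α < 2 * (j : ℝ)) (ξ : ℝ) :
    𝓕 (truncRiesz α j f ε) ξ = (((2 * Real.pi * |ξ|) ^ α *
      (sinKernelTail α j (Real.pi * |ξ| * ε) / sinKernelTail α j 0) : ℝ) : ℂ) * 𝓕 f ξ := by
  have hj0 : j ≠ 0 := by
    rintro rfl
    norm_num at hj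
    linarith
  have hA := sinKernelTail_zero_pos hα hj
  have hint := integrable_centralDiff_div_rpow hf hfc hα hε j
  have hstep : 𝓕 (fun x => ∫ u in Ioi ε, centralDiff j u f x / ((u ^ (1 + α) : ℝ) : ℂ)) ξ =
      ∫ u in Ioi ε, 𝓕 (centralDiff j u f) ξ / ((u ^ (1 + α) : ℝ) : ℂ) := by
    simp_rw [Real.fourier_real_eq_integral_exp_smul, smul_eq_mul, ← integral_const_mul,
      ← integral_div, mul_div_assoc]
    refine integral_integral_swap ?_
    refine hint.bdd_mul (c := 1) (f := fun p : ℝ × ℝ =>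
      Complex.exp (((-2 * Real.pi * p.1 * ξ : ℝ) : ℂ) * Complex.I)) (by fun_prop)
      (Eventually.of_forall fun p => ?_)
    rw [Complex.norm_exp_ofReal_mul_I]
  have h1 : 𝓕 (truncRiesz α j f ε) ξ = ((1 / rieszConst α j : ℝ) : ℂ) *
      𝓕 (fun x => ∫ u in Ioi ε, centralDiff j u f x / ((u ^ (1 + α) : ℝ) : ℂ)) ξ :=
    fourier_const_mul _ _ ξ
  have h2 : ∀ u : ℝ, 𝓕 (centralDiff j u f) ξ / ((u ^ (1 + α) : ℝ) : ℂ) =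
      (-4) ^ j * 𝓕 f ξ * ((Real.sin (Real.pi * ξ * u) ^ (2 * j) / u ^ (1 + α) : ℝ) : ℂ) :=
    fun u => by
      rw [fourier_centralDiff hf]
      push_cast
      ring
  rw [h1, hstep]
  simp_rw [h2]
  rw [integral_const_mul, integral_complex_ofReal, integral_sin_pow_div_rpow hα hj0 hε,
    rieszConst_eq]
  have h4 : ((-4 : ℝ) ^ j) ≠ 0 := pow_ne_zero _ (by norm_num)
  have e : (-4 : ℂ) ^ j = (((-4 : ℝ) ^ j : ℝ) : ℂ) := by push_cast; rfl
  have h5 : (2 * Real.pi * |ξ|) ^ α = 2 ^ α * (Real.pi * |ξ|) ^ α := by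
    rw [mul_assoc, Real.mul_rpow zero_le_two (by positivity)]
  have h6 : (2 : ℝ) ^ (-α) = (2 ^ α)⁻¹ := Real.rpow_neg zero_le_two α
  have h7 : (2 : ℝ) ^ α ≠ 0 := by positivity
  rw [h5, h6, e]
  rw [mul_right_comm _ (𝓕 f ξ), ← mul_assoc]
  congr 1
  norm_cast
  field_simp

/-- Passing to the limit in the multipliers: a strong Riesz derivative is given by the Fourier
multiplier `|v|^α`. -/
lemma IsStrongRieszDeriv.fourier_eq {α : ℝ} {f g : ℝ → ℂ} (hfc : Continuous f)
    (h : IsStrongRieszDeriv α f g) (ξ : ℝ) :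
    𝓕 g ξ = (((2 * Real.pi * |ξ|) ^ α : ℝ) : ℂ) * 𝓕 f ξ := by
  obtain ⟨hf, hg, j, hα, hj, hlim⟩ := h
  have hA := sinKernelTail_zero_pos hα hj
  have h1 : Tendsto (fun ε => 𝓕 (truncRiesz α j f ε) ξ) (𝓝[>] 0) (𝓝 (𝓕 g ξ)) := by
    rw [tendsto_iff_norm_sub_tendsto_zero]
    have hr := (ENNReal.tendsto_toReal ENNReal.zero_ne_top).comp hlim
    refine squeeze_zero' (Eventually.of_forall fun _ => norm_nonneg _) ?_ hr
    filter_upwards [self_mem_nhdsWithin] with ε hε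
    have hT := integrable_truncRiesz hf hfc hα hε j
    have hsub : 𝓕 (truncRiesz α j f ε) ξ - 𝓕 g ξ =
        𝓕 (fun x => truncRiesz α j f ε x - g x) ξ := by
      simp_rw [Real.fourier_real_eq_integral_exp_smul, smul_eq_mul, mul_sub]
      rw [integral_sub (integrable_exp_mul hT ξ) (integrable_exp_mul hg ξ)]
    rw [hsub]
    refine (norm_fourier_le_integral _ ξ).trans_eq ?_
    rw [Function.comp_apply, eLpNorm_one_eq_lintegral_enorm]
    exact integral_norm_eq_lintegral_enorm (hT.sub hg).aestronglyMeasurable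
  have h2 : Tendsto (fun ε => 𝓕 (truncRiesz α j f ε) ξ) (𝓝[>] 0)
      (𝓝 ((((2 * Real.pi * |ξ|) ^ α : ℝ) : ℂ) * 𝓕 f ξ)) := by
    have ht : Tendsto (fun ε : ℝ => Real.pi * |ξ| * ε) (𝓝[>] 0) (𝓝[≥] 0) := by
      refine tendsto_nhdsWithin_iff.2 ⟨?_, ?_⟩
      · have : Tendsto (fun ε : ℝ => Real.pi * |ξ| * ε) (𝓝 0) (𝓝 (Real.pi * |ξ| * 0)) :=
          tendsto_id.const_mul _
        rw [mul_zero] at this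
        exact this.mono_left nhdsWithin_le_nhds
      · filter_upwards [self_mem_nhdsWithin] with ε hε
        have : (0 : ℝ) < ε := hε
        exact mul_nonneg (by positivity) this.le
    have h3 := (((tendsto_sinKernelTail hα hj).comp ht).div_const (sinKernelTail α j 0)).const_mul
      ((2 * Real.pi * |ξ|) ^ α)
    rw [div_self hA.ne', mul_one] at h3
    refine (((Complex.continuous_ofReal.tendsto _).comp h3).mul_const (𝓕 f ξ)).congr' ?_
    filter_upwards [self_mem_nhdsWithin] with ε hε
    exact (fourier_truncRiesz hf hfc hα hε hj ξ).symm
  exact tendsto_nhds_unique h1 h2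

/-! ### Approximate identities in `L¹` -/

lemma tendsto_eLpNorm_comp_sub_sub {g : ℝ → ℂ} (hg : Integrable g) :
    Tendsto (fun t : ℝ => eLpNorm (fun x => g (x - t) - g x) 1 volume) (𝓝 0) (𝓝 0) := by
  have hm := memLp_one_iff_integrable.2 hg
  let G : C(ℝ, C(ℝ, ℝ)) :=
    (ContinuousMap.mk (fun a : ℝ × ℝ => a.2 - a.1) (by fun_prop)).curry
  have hG : ∀ t, MeasurePreserving (G t) volume volume := fun t =>
    measurePreserving_sub_right volume t
  have h := Tendsto.compMeasurePreservingLp (p := 1) (f := fun _ : ℝ => hm.toLp g)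
    tendsto_const_nhds (G.continuous.tendsto 0) hG (hG 0) ENNReal.one_ne_top
  simp_rw [Lp.toLp_compMeasurePreserving hm] at h
  rw [Lp.tendsto_Lp_iff_tendsto_eLpNorm''] at h
  refine h.congr fun t => ?_
  congr 1
  ext x
  simp [G]

/-- The dilates `ε⁻¹ q(ε⁻¹ x)` of a kernel. -/
def dilate (q : ℝ → ℂ) (ε : ℝ) (x : ℝ) : ℂ := (ε : ℂ)⁻¹ * q (ε⁻¹ * x)

/-- The change of variables is valid for every `q`: if `q` is not integrable, both sides vanish. -/
lemma fourier_dilate (q : ℝ → ℂ) {ε : ℝ} (hε : 0 < ε) (ξ : ℝ) :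
    𝓕 (dilate q ε) ξ = 𝓕 q (ε * ξ) := by
  rw [Real.fourier_real_eq_integral_exp_smul, Real.fourier_real_eq_integral_exp_smul]
  have h := Measure.integral_comp_mul_left (fun x : ℝ =>
    Complex.exp (((-2 * Real.pi * x * (ε * ξ) : ℝ) : ℂ) * Complex.I) • q x) ε⁻¹
  rw [inv_inv, abs_of_pos hε] at h
  have h' := congrArg (fun z => (ε : ℂ)⁻¹ * z) h
  simp only [Complex.real_smul] at h'
  rw [inv_mul_cancel_left₀ (by exact_mod_cast hε.ne')] at h'
  rw [← h', ← integral_const_mul]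
  congr 1
  ext x
  have e : -2 * Real.pi * (ε⁻¹ * x) * (ε * ξ) = -2 * Real.pi * x * ξ := by
    field_simp
  rw [e, dilate, smul_eq_mul, smul_eq_mul]
  ring

lemma continuous_dilate {q : ℝ → ℂ} (hq : Continuous q) (ε : ℝ) : Continuous (dilate q ε) := by
  unfold dilate; fun_prop

lemma integrable_dilate {q : ℝ → ℂ} (hq : Integrable q) {ε : ℝ} (hε : 0 < ε) :
    Integrable (dilate q ε) :=
  (hq.comp_mul_left' (inv_ne_zero hε.ne')).const_mul _

lemma norm_dilate_le {q : ℝ → ℂ} {K : ℝ} (hK : ∀ x, ‖q x‖ ≤ K) {ε : ℝ} (hε : 0 < ε) (x : ℝ) :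
    ‖dilate q ε x‖ ≤ ε⁻¹ * K := by
  rw [dilate, norm_mul, norm_inv, Complex.norm_real, Real.norm_of_nonneg hε.le]
  exact mul_le_mul_of_nonneg_left (hK _) (by positivity)

lemma convolution_dilate_eq (g q : ℝ → ℂ) {ε : ℝ} (hε : 0 < ε) (x : ℝ) :
    convolution g (dilate q ε) (ContinuousLinearMap.mul ℂ ℂ) volume x =
      ∫ s, g (x - ε * s) * q s := by
  have h := Measure.integral_comp_mul_left (fun y => g (x - ε * y) * q y) ε⁻¹
  rw [inv_inv, abs_of_pos hε, Complex.real_smul] at h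
  have h' := congrArg (fun z => (ε : ℂ)⁻¹ * z) h
  rw [inv_mul_cancel_left₀ (by exact_mod_cast hε.ne')] at h'
  rw [← h', ← integral_const_mul, ← integral_sub_left_eq_self _ _ x]
  refine integral_congr_ae (Eventually.of_forall fun t => ?_)
  simp only [dilate, ContinuousLinearMap.mul_apply', mul_inv_cancel_left₀ hε.ne', sub_sub_cancel]
  ring

/-- The dilates of a kernel of integral one form an approximate identity in `L¹`. -/
lemma tendsto_eLpNorm_convolution_dilate {g q : ℝ → ℂ} (hg : Integrable g)
    (hgm : StronglyMeasurable g) (hq : Integrable q) (hqc : Continuous q) {K : ℝ}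
    (hK : ∀ x, ‖q x‖ ≤ K) (hq1 : ∫ s, q s = 1) :
    Tendsto (fun ε => eLpNorm (fun x =>
      convolution g (dilate q ε) (ContinuousLinearMap.mul ℂ ℂ) volume x - g x) 1 volume)
      (𝓝[>] 0) (𝓝 0) := by
  let I : ℝ → ENNReal := fun t => eLpNorm (fun x => g (x - t) - g x) 1 volume
  have hI0 : Tendsto I (𝓝 0) (𝓝 0) := tendsto_eLpNorm_comp_sub_sub hg
  have hIm : Measurable I := by
    simp only [I, eLpNorm_one_eq_lintegral_enorm]
    have := hgm.measurable
    exact Measurable.lintegral_prod_right' (f := fun p : ℝ × ℝ => ‖g (p.2 - p.1) - g p.2‖ₑ)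
      (by fun_prop)
  have hIle : ∀ t, I t ≤ 2 * eLpNorm g 1 volume := fun t => by
    have hmp := measurePreserving_sub_right (volume : Measure ℝ) t
    have e : eLpNorm (fun x => g (x - t)) 1 volume = eLpNorm g 1 volume :=
      eLpNorm_comp_measurePreserving hgm.aestronglyMeasurable hmp
    refine (eLpNorm_sub_le (f := fun x => g (x - t)) (g := g)
      (hg.comp_sub_right t).aestronglyMeasurable hg.aestronglyMeasurable le_rfl).trans ?_
    rw [e, two_mul]
  have hbound : ∀ ε : ℝ, 0 < ε → eLpNorm (fun x =>
      convolution g (dilate q ε) (ContinuousLinearMap.mul ℂ ℂ) volume x - g x) 1 volume ≤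
      ∫⁻ s, ‖q s‖ₑ * I (ε * s) := fun ε hε => by
    have hpt : ∀ x, ‖convolution g (dilate q ε) (ContinuousLinearMap.mul ℂ ℂ) volume x - g x‖ₑ ≤
        ∫⁻ s, ‖q s‖ₑ * ‖g (x - ε * s) - g x‖ₑ := fun x => by
      have i1 : Integrable fun s => g (x - ε * s) * q s :=
        ((hg.comp_sub_left x).comp_mul_left' hε.ne').mul_bdd (c := K) hqc.aestronglyMeasurable
          (Eventually.of_forall hK)
      have e : convolution g (dilate q ε) (ContinuousLinearMap.mul ℂ ℂ) volume x - g x =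
          ∫ s, q s * (g (x - ε * s) - g x) := by
        rw [convolution_dilate_eq g q hε]
        have : g x = ∫ s, g x * q s := by rw [integral_const_mul, hq1, mul_one]
        conv_lhs => rw [this]
        rw [← integral_sub i1 (hq.const_mul _)]
        congr 1
        ext s
        ring
      rw [e]
      refine (enorm_integral_le_lintegral_enorm _).trans_eq ?_
      simp_rw [enorm_mul]
    rw [eLpNorm_one_eq_lintegral_enorm]
    refine (lintegral_mono hpt).trans_eq ?_
    have hgm' := hgm.measurable
    have hqm := hqc.measurable
    rw [lintegral_lintegral_swap (by
      refine Measurable.aemeasurable ?_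
      unfold Function.uncurry
      fun_prop)]
    refine lintegral_congr fun s => ?_
    simp only [I, eLpNorm_one_eq_lintegral_enorm]
    rw [lintegral_const_mul]
    fun_prop
  have hlim : Tendsto (fun ε : ℝ => ∫⁻ s, ‖q s‖ₑ * I (ε * s)) (𝓝[>] 0) (𝓝 0) := by
    have hz : (0 : ENNReal) = ∫⁻ _ : ℝ, 0 := by simp
    rw [hz]
    refine tendsto_lintegral_filter_of_dominated_convergence
      (fun s => ‖q s‖ₑ * (2 * eLpNorm g 1 volume)) (Eventually.of_forall fun ε => ?_)
      (Eventually.of_forall fun ε => Eventually.of_forall fun s => ?_) ?_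
      (Eventually.of_forall fun s => ?_)
    · have hqm := hqc.measurable
      fun_prop
    · exact mul_le_mul_right (hIle _) _
    · rw [lintegral_mul_const _ hqc.measurable.enorm]
      exact ENNReal.mul_ne_top hq.2.ne (ENNReal.mul_ne_top ENNReal.ofNat_ne_top
        (memLp_one_iff_integrable.2 hg).2.ne)
    · have ht : Tendsto (fun ε : ℝ => ε * s) (𝓝[>] 0) (𝓝 0) := by
        have : Tendsto (fun ε : ℝ => ε * s) (𝓝 0) (𝓝 (0 * s)) := tendsto_id.mul_const s
        rw [zero_mul] at this
        exact this.mono_left nhdsWithin_le_nhds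
      have := ENNReal.Tendsto.const_mul (a := ‖q s‖ₑ) (hI0.comp ht) (Or.inr enorm_ne_top)
      simpa using this
  refine tendsto_of_tendsto_of_tendsto_of_le_of_le' tendsto_const_nhds hlim
    (Eventually.of_forall fun _ => zero_le) ?_
  filter_upwards [self_mem_nhdsWithin] with ε hε using hbound ε hε

/-! ### The truncated hypersingular integral as a convolution -/

section Multiplier

variable {α : ℝ} {f g : ℝ → ℂ}

lemma norm_fourier_eq_of_multiplier
    (hfg : ∀ ξ, 𝓕 g ξ = (((2 * Real.pi * |ξ|) ^ α : ℝ) : ℂ) * 𝓕 f ξ) {ξ : ℝ} (hξ : ξ ≠ 0) :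
    ‖𝓕 f ξ‖ = (2 * Real.pi * |ξ|) ^ (-α) * ‖𝓕 g ξ‖ := by
  have h0 : 0 < 2 * Real.pi * |ξ| := by positivity
  rw [hfg, norm_mul, Complex.norm_real, Real.norm_of_nonneg (by positivity), ← mul_assoc,
    ← Real.rpow_add h0, neg_add_cancel, Real.rpow_zero, one_mul]

lemma integrable_fourier_of_multiplier (hα : 1 < α) (hf : Integrable f)
    (hfg : ∀ ξ, 𝓕 g ξ = (((2 * Real.pi * |ξ|) ^ α : ℝ) : ℂ) * 𝓕 f ξ) : Integrable (𝓕 f) := by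
  refine integrable_of_norm_le_of_norm_le_rpow (continuous_fourier hf) hα
    (B := ∫ x, ‖g x‖) (integral_nonneg fun x => norm_nonneg (g x)) (norm_fourier_le_integral f)
    fun ξ hξ => ?_
  have hξ0 : 0 < |ξ| := by linarith
  rw [norm_fourier_eq_of_multiplier hfg (abs_pos.1 hξ0), mul_comm]
  refine mul_le_mul (norm_fourier_le_integral g ξ) ?_ (by positivity)
    (integral_nonneg fun x => norm_nonneg (g x))
  refine Real.rpow_le_rpow_of_nonpos hξ0 ?_ (by linarith)
  nlinarith [Real.pi_gt_three]

lemma exists_norm_le_of_integrable_fourier (hf : Integrable f) (hfc : Continuous f)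
    (hF : Integrable (𝓕 f)) : ∃ M, ∀ x, ‖f x‖ ≤ M := by
  refine ⟨∫ ξ, ‖𝓕 f ξ‖, fun x => ?_⟩
  conv_lhs => rw [← hfc.fourierInv_fourier_eq hf hF, Real.fourierInv_eq_fourier_neg]
  exact norm_fourier_le_integral _ _

lemma integrableOn_comp_add_mul_div_rpow (hfc : Continuous f) {M : ℝ} (hM : ∀ x, ‖f x‖ ≤ M)
    (hα : 0 < α) {ε : ℝ} (hε : 0 < ε) (m x : ℝ) :
    IntegrableOn (fun u => f (x + m * u) / ((u ^ (1 + α) : ℝ) : ℂ)) (Ioi ε) := by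
  have hpow : IntegrableOn (fun u : ℝ => u ^ (-(1 + α))) (Ioi ε) :=
    integrableOn_Ioi_rpow_of_lt (by linarith) hε
  have hfm := hfc.measurable
  refine Integrable.mono' (hpow.const_mul M)
    (Measurable.aestronglyMeasurable (by fun_prop)) ?_
  filter_upwards [ae_restrict_mem measurableSet_Ioi] with u hu
  have hu : (0 : ℝ) < u := hε.trans hu
  rw [norm_div, Complex.norm_real, Real.norm_of_nonneg (by positivity), Real.rpow_neg hu.le,
    div_eq_mul_inv]
  exact mul_le_mul_of_nonneg_right (hM _) (by positivity)

lemma continuous_integral_comp_add_mul_div_rpow (hfc : Continuous f) {M : ℝ}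
    (hM : ∀ x, ‖f x‖ ≤ M) (hα : 0 < α) {ε : ℝ} (hε : 0 < ε) (m : ℝ) :
    Continuous fun x => ∫ u in Ioi ε, f (x + m * u) / ((u ^ (1 + α) : ℝ) : ℂ) := by
  have hpow : IntegrableOn (fun u : ℝ => u ^ (-(1 + α))) (Ioi ε) :=
    integrableOn_Ioi_rpow_of_lt (by linarith) hε
  refine continuous_of_dominated (bound := fun u => M * u ^ (-(1 + α)))
    (fun x => (integrableOn_comp_add_mul_div_rpow hfc hM hα hε m x).aestronglyMeasurable)
    (fun x => ?_) (hpow.const_mul M) (Eventually.of_forall fun u => by fun_prop)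
  filter_upwards [ae_restrict_mem measurableSet_Ioi] with u hu
  have hu : (0 : ℝ) < u := hε.trans hu
  rw [norm_div, Complex.norm_real, Real.norm_of_nonneg (by positivity), Real.rpow_neg hu.le,
    div_eq_mul_inv]
  exact mul_le_mul_of_nonneg_right (hM _) (by positivity)

lemma truncRiesz_eq_sum (hfc : Continuous f) {M : ℝ} (hM : ∀ x, ‖f x‖ ≤ M) (hα : 0 < α) {ε : ℝ}
    (hε : 0 < ε) (j : ℕ) (x : ℝ) :
    truncRiesz α j f ε x = ((1 / rieszConst α j : ℝ) : ℂ) * ∑ k ∈ Finset.range (2 * j + 1),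
      (-1 : ℂ) ^ k * ((2 * j).choose k : ℂ) *
        ∫ u in Ioi ε, f (x + ((j : ℝ) - (k : ℝ)) * u) / ((u ^ (1 + α) : ℝ) : ℂ) := by
  rw [truncRiesz]
  simp_rw [centralDiff_div]
  rw [integral_finsetSum _ fun k _ =>
    (integrableOn_comp_add_mul_div_rpow hfc hM hα hε _ x).const_mul _]
  simp_rw [integral_const_mul]

lemma continuous_truncRiesz (hfc : Continuous f) {M : ℝ} (hM : ∀ x, ‖f x‖ ≤ M) (hα : 0 < α)
    {ε : ℝ} (hε : 0 < ε) (j : ℕ) : Continuous (truncRiesz α j f ε) := by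
  have h : truncRiesz α j f ε = _ := funext (truncRiesz_eq_sum hfc hM hα hε j)
  rw [h]
  exact continuous_const.mul (continuous_finsetSum _ fun k _ =>
    continuous_const.mul (continuous_integral_comp_add_mul_div_rpow hfc hM hα hε _))

/-- If `ĝ = |v|^α f̂`, then the truncated hypersingular integrals of `f` are the convolutions of `g`
with the dilates of a fixed kernel: both sides are continuous and integrable and have the same
Fourier transform. -/
lemma truncRiesz_eq_convolution (hα : 1 < α) (hf : Integrable f) (hfc : Continuous f)
    (hg : Integrable g) (hfg : ∀ ξ, 𝓕 g ξ = (((2 * Real.pi * |ξ|) ^ α : ℝ) : ℂ) * 𝓕 f ξ)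
    {j : ℕ} (hj : α < 2 * (j : ℝ)) {q : ℝ → ℂ} (hq : Integrable q) (hqc : Continuous q) {K : ℝ}
    (hK : ∀ x, ‖q x‖ ≤ K)
    (hF : ∀ ξ, 𝓕 q ξ = ((sinKernelTail α j (Real.pi * |ξ|) / sinKernelTail α j 0 : ℝ) : ℂ))
    {ε : ℝ} (hε : 0 < ε) :
    truncRiesz α j f ε =
      convolution g (dilate q ε) (ContinuousLinearMap.mul ℂ ℂ) volume := by
  have h0 : 0 < α := by linarith
  obtain ⟨M, hM⟩ := exists_norm_le_of_integrable_fourier hf hfc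
    (integrable_fourier_of_multiplier hα hf hfg)
  set T := truncRiesz α j f ε with hT
  set G := convolution g (dilate q ε) (ContinuousLinearMap.mul ℂ ℂ) volume with hG
  have hTc : Continuous T := continuous_truncRiesz hfc hM h0 hε j
  have hTi : Integrable T := integrable_truncRiesz hf hfc h0 hε j
  have hGc : Continuous G := BddAbove.continuous_convolution_right_of_integrable _
    ⟨ε⁻¹ * K, by rintro _ ⟨x, rfl⟩; exact norm_dilate_le hK hε x⟩ hg (continuous_dilate hqc ε)
  have hGi : Integrable G := hg.integrable_convolution _ (integrable_dilate hq hε)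
  have hzero : 𝓕 (T - G) = 0 := by
    ext ξ
    have hsub : 𝓕 (T - G) ξ = 𝓕 T ξ - 𝓕 G ξ := by
      simp_rw [Real.fourier_real_eq_integral_exp_smul, smul_eq_mul, Pi.sub_apply, mul_sub]
      rw [integral_sub (integrable_exp_mul hTi ξ) (integrable_exp_mul hGi ξ)]
    rw [hsub, hT, fourier_truncRiesz hf hfc h0 hε hj, hG,
      Real.fourier_mul_convolution_eq hg (integrable_dilate hq hε), fourier_dilate q hε, hF, hfg,
      abs_mul, abs_of_pos hε, Pi.zero_apply]
    have : Real.pi * (ε * |ξ|) = Real.pi * |ξ| * ε := by ring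
    rw [this]
    push_cast
    ring
  have hinv := (hTc.sub hGc).fourierInv_fourier_eq (hTi.sub hGi) (by
    change Integrable (𝓕 (T - G))
    rw [hzero]
    exact integrable_zero _ _ _)
  change 𝓕⁻ (𝓕 (T - G)) = T - G at hinv
  rw [hzero] at hinv
  have hz : 𝓕⁻ (0 : ℝ → ℂ) = 0 := by
    ext x
    simp [Real.fourierInv_eq_fourier_neg, Real.fourier_real_eq_integral_exp_smul]
  rw [hz] at hinv
  exact sub_eq_zero.1 hinv.symm

/-- A function whose Fourier transform is `|v|^α f̂` is the strong Riesz derivative of `f`. -/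
lemma isStrongRieszDeriv_of_fourier_eq (hα : 1 < α) (hf : Integrable f) (hfc : Continuous f)
    (hg : Integrable g) (hgm : StronglyMeasurable g)
    (hfg : ∀ ξ, 𝓕 g ξ = (((2 * Real.pi * |ξ|) ^ α : ℝ) : ℂ) * 𝓕 f ξ) :
    IsStrongRieszDeriv α f g := by
  have h0 : 0 < α := by linarith
  obtain ⟨j, hj⟩ := exists_nat_ge (α + 3)
  have hj : α + 3 ≤ 2 * (j : ℝ) := by linarith
  have hj' : α < 2 * (j : ℝ) := by linarith
  obtain ⟨q, K, hqc, hqK, hqF⟩ := exists_kernel_fourier_eq hα hj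
  have hq := integrable_of_norm_le_inv_one_add_sq hqc hqK
  have hK : ∀ x, ‖q x‖ ≤ K := fun x => by
    have h1 := hqK x
    have h2 : 0 ≤ K := by simpa using (norm_nonneg _).trans (hqK 0)
    refine h1.trans (mul_le_of_le_one_right h2 (inv_le_one_of_one_le₀ ?_))
    nlinarith
  have hq1 : ∫ s, q s = 1 := by
    have h := hqF 0
    rw [abs_zero, mul_zero, div_self (sinKernelTail_zero_pos h0 hj').ne'] at h
    simpa [Real.fourier_real_eq_integral_exp_smul] using h
  refine ⟨hf, hg, j, h0, hj', ?_⟩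
  refine (tendsto_eLpNorm_convolution_dilate hg hgm hq hqc hK hq1).congr' ?_
  filter_upwards [self_mem_nhdsWithin] with ε hε
  rw [truncRiesz_eq_convolution hα hf hfc hg hfg hj' hq hqc hK hqF hε]

end Multiplier

/-! ### Poisson summation for functions with a Riesz derivative -/

/-- The convolution of `F` with `1/(1+x²)`. A function dominated by it, for some `F ∈ L¹`, has
absolutely summable samples, uniformly under bounded shifts. -/
def cauchyMean (F : ℝ → ℝ) (x : ℝ) : ℝ := ∫ t, F t * (1 + (x - t) ^ 2)⁻¹

lemma inv_one_add_sq_add_le (a y : ℝ) :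
    (1 + (a + y) ^ 2)⁻¹ ≤ 2 * (1 + y ^ 2) * (1 + a ^ 2)⁻¹ := by
  rw [← div_eq_mul_inv, inv_eq_one_div, div_le_div_iff₀ (by positivity) (by positivity)]
  nlinarith [sq_nonneg (a + 2 * y), sq_nonneg (y * (a + y))]

section CauchyMean

variable {F : ℝ → ℝ}

lemma integrable_mul_inv_one_add_sq (hF : Integrable F) (x : ℝ) :
    Integrable fun t => F t * (1 + (x - t) ^ 2)⁻¹ := by
  refine hF.mul_bdd (c := 1) (Measurable.aestronglyMeasurable (by fun_prop))
    (Eventually.of_forall fun t => ?_)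
  rw [Real.norm_of_nonneg (by positivity)]
  exact inv_le_one_of_one_le₀ (by nlinarith [sq_nonneg (x - t)])

lemma cauchyMean_nonneg (h0 : ∀ t, 0 ≤ F t) (x : ℝ) : 0 ≤ cauchyMean F x :=
  integral_nonneg fun t => mul_nonneg (h0 t) (by positivity)

lemma cauchyMean_add_le (hF : Integrable F) (h0 : ∀ t, 0 ≤ F t) (x y : ℝ) :
    cauchyMean F (x + y) ≤ 2 * (1 + y ^ 2) * cauchyMean F x := by
  rw [cauchyMean, cauchyMean, ← integral_const_mul]
  refine integral_mono (integrable_mul_inv_one_add_sq hF _)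
    ((integrable_mul_inv_one_add_sq hF _).const_mul _) fun t => ?_
  have h := mul_le_mul_of_nonneg_left (inv_one_add_sq_add_le (x - t) y) (h0 t)
  have e : x + y - t = x - t + y := by ring
  simp only [e]
  linarith

lemma cauchyMean_mono {G : ℝ → ℝ} (hF : Integrable F) (hG : Integrable G) (h : ∀ t, F t ≤ G t)
    (x : ℝ) : cauchyMean F x ≤ cauchyMean G x :=
  integral_mono (integrable_mul_inv_one_add_sq hF x) (integrable_mul_inv_one_add_sq hG x)
    fun t => mul_le_mul_of_nonneg_right (h t) (by positivity)

lemma summable_inv_one_add_mul_sq {h : ℝ} (hh : 0 < h) :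
    Summable fun n : ℤ => (1 + (h * n) ^ 2)⁻¹ := by
  refine Summable.of_norm_bounded_eventually
    (((Real.summable_one_div_int_pow (p := 2)).2 one_lt_two).mul_left (h ^ 2)⁻¹) ?_
  filter_upwards [(finite_singleton (0 : ℤ)).compl_mem_cofinite] with n hn
  have hn : (n : ℝ) ≠ 0 := by exact_mod_cast hn
  rw [Real.norm_of_nonneg (by positivity), one_div, ← mul_inv, ← mul_pow]
  exact inv_anti₀ (by positivity) (by linarith)

/-- The bound is uniform in `t`, since the sum over the grid is periodic in `t`. -/
lemma sum_inv_one_add_sq_le {h : ℝ} (hh : 0 < h) (s : Finset ℤ) (t : ℝ) :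
    ∑ n ∈ s, (1 + (h * n - t) ^ 2)⁻¹ ≤
      2 * (1 + h ^ 2) * ∑' n : ℤ, (1 + (h * n) ^ 2)⁻¹ := by
  -- Shifting by the grid point `h * m` nearest to `t` from below leaves an offset of at most `h`.
  set m : ℤ := ⌊t / h⌋ with hm
  have h1 : h * m ≤ t := by
    have := mul_le_mul_of_nonneg_left (Int.floor_le (t / h)) hh.le
    rwa [mul_div_cancel₀ _ hh.ne'] at this
  have h2 : t ≤ h * m + h := by
    have := mul_le_mul_of_nonneg_left (Int.lt_floor_add_one (t / h)).le hh.le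
    rw [mul_div_cancel₀ _ hh.ne'] at this
    linarith
  have hs := (Equiv.subRight m).summable_iff.2 (summable_inv_one_add_mul_sq hh)
  calc ∑ n ∈ s, (1 + (h * n - t) ^ 2)⁻¹
      ≤ ∑ n ∈ s, 2 * (1 + h ^ 2) * (1 + (h * ((n - m : ℤ) : ℝ)) ^ 2)⁻¹ := by
        refine Finset.sum_le_sum fun n _ => ?_
        have e : h * n - t = h * ((n - m : ℤ) : ℝ) + (h * m - t) := by push_cast; ring
        rw [e]
        refine (inv_one_add_sq_add_le _ _).trans ?_
        gcongr 2 * (1 + ?_) * _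
        nlinarith
    _ = 2 * (1 + h ^ 2) * ∑ n ∈ s, (1 + (h * ((n - m : ℤ) : ℝ)) ^ 2)⁻¹ := by
        rw [Finset.mul_sum]
    _ ≤ 2 * (1 + h ^ 2) * ∑' n : ℤ, (1 + (h * n) ^ 2)⁻¹ := by
        rw [← (Equiv.subRight m).tsum_eq]
        gcongr
        exact hs.sum_le_tsum s fun n _ => by positivity

lemma summable_cauchyMean (hF : Integrable F) (h0 : ∀ t, 0 ≤ F t) {h : ℝ} (hh : 0 < h) :
    Summable fun n : ℤ => cauchyMean F (h * n) := by
  set c := 2 * (1 + h ^ 2) * ∑' n : ℤ, (1 + (h * n) ^ 2)⁻¹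
  refine summable_of_sum_le (c := (∫ t, F t) * c) (fun n => cauchyMean_nonneg h0 _) fun s => ?_
  simp only [cauchyMean]
  rw [← integral_finsetSum s fun n _ => integrable_mul_inv_one_add_sq hF _, ← integral_mul_const]
  refine integral_mono (integrable_finsetSum s fun n _ => integrable_mul_inv_one_add_sq hF _)
    (hF.mul_const c) fun t => ?_
  simp only [← Finset.mul_sum]
  exact mul_le_mul_of_nonneg_left (sum_inv_one_add_sq_le hh s t) (h0 t)

end CauchyMean

section Multiplier

variable {α : ℝ} {f g : ℝ → ℂ}

lemma norm_integral_comp_add_mul_le (hf : Integrable f) (hα : 1 < α) {m : ℝ} (hm : 1 ≤ |m|)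
    (x : ℝ) :
    ‖∫ u in Ioi (1 : ℝ), f (x + m * u) / ((u ^ (1 + α) : ℝ) : ℂ)‖ ≤
      2 * |m| * cauchyMean (fun t => ‖f t‖) x := by
  have hm0 : m ≠ 0 := abs_pos.1 (by linarith)
  let φ : ℝ → ℝ := fun y => ‖f (x + y)‖ * (2 * m ^ 2 * (1 + y ^ 2)⁻¹)
  have hφ : Integrable φ := by
    have := ((integrable_mul_inv_one_add_sq hf.norm x).const_mul (2 * m ^ 2)).comp_add_left x
    refine this.congr (Eventually.of_forall fun y => ?_)
    simp only [φ]
    ring_nf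
  have hφm : Integrable fun u => φ (m * u) := hφ.comp_mul_left' hm0
  have hpt : ∀ u ∈ Ioi (1 : ℝ), ‖f (x + m * u) / ((u ^ (1 + α) : ℝ) : ℂ)‖ ≤ φ (m * u) := by
    intro u hu
    have hu1 : (1 : ℝ) < u := hu
    have hu0 : (0 : ℝ) < u := by linarith
    rw [norm_div, Complex.norm_real, Real.norm_of_nonneg (by positivity), div_eq_mul_inv]
    refine mul_le_mul_of_nonneg_left ?_ (norm_nonneg _)
    have h1 : u ^ 2 ≤ u ^ (1 + α) := by
      rw [← Real.rpow_two]
      exact Real.rpow_le_rpow_of_exponent_le hu1.le (by linarith)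
    have hm2 : 1 ≤ m ^ 2 := by rw [← sq_abs]; nlinarith
    refine (inv_anti₀ (by positivity) h1).trans ?_
    rw [← div_eq_mul_inv, inv_eq_one_div, div_le_div_iff₀ (by positivity) (by positivity)]
    nlinarith [mul_le_mul hm2 hu1.le zero_le_one (by positivity), mul_pos hu0 hu0,
      mul_nonneg (sub_nonneg.2 hm2) (sq_nonneg u), mul_nonneg (sq_nonneg m) (sub_nonneg.2
        (one_le_pow₀ hu1.le : (1 : ℝ) ≤ u ^ 2))]
  refine (norm_integral_le_integral_norm _).trans ?_
  have hint : ∫ u, φ (m * u) = 2 * |m| * cauchyMean (fun t => ‖f t‖) x := by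
    rw [Measure.integral_comp_mul_left, smul_eq_mul, cauchyMean,
      ← integral_add_left_eq_self (fun t => ‖f t‖ * (1 + (x - t) ^ 2)⁻¹) x,
      ← integral_const_mul, ← integral_const_mul]
    refine integral_congr_ae (Eventually.of_forall fun y => ?_)
    simp only [φ, abs_inv, sub_add_cancel_left, neg_sq, ← sq_abs m]
    field_simp
  rw [← hint]
  calc ∫ u in Ioi (1 : ℝ), ‖f (x + m * u) / ((u ^ (1 + α) : ℝ) : ℂ)‖
      ≤ ∫ u in Ioi (1 : ℝ), φ (m * u) := by
        refine integral_mono_of_nonneg (Eventually.of_forall fun u => norm_nonneg _)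
          hφm.integrableOn ?_
        filter_upwards [ae_restrict_mem measurableSet_Ioi] with u hu using hpt u hu
    _ ≤ ∫ u, φ (m * u) :=
        setIntegral_le_integral hφm (Eventually.of_forall fun u => by positivity)

/-- A continuous `f ∈ L¹` with `|v|^α f̂ = ĝ`, `g ∈ L¹`, is dominated by the convolution of an
integrable function with `1/(1+x²)`: in the truncated hypersingular integral over `(1, ∞)` the
central term is a multiple of `f`, the other terms are convolutions of `f` with kernels that decay
like `|x|^{-1-α}`, and the whole is the convolution of `g` with a kernel of quadratic decay. -/
lemma exists_norm_le_cauchyMean (hα : 1 < α) (hf : Integrable f) (hfc : Continuous f)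
    (hg : Integrable g) (hfg : ∀ ξ, 𝓕 g ξ = (((2 * Real.pi * |ξ|) ^ α : ℝ) : ℂ) * 𝓕 f ξ) :
    ∃ C, 0 ≤ C ∧ ∀ x, ‖f x‖ ≤ C * cauchyMean (fun t => ‖f t‖ + ‖g t‖) x := by
  have h0 : 0 < α := by linarith
  obtain ⟨j, hj⟩ := exists_nat_ge (α + 3)
  have hj : α + 3 ≤ 2 * (j : ℝ) := by linarith
  have hj' : α < 2 * (j : ℝ) := by linarith
  obtain ⟨M, hM⟩ := exists_norm_le_of_integrable_fourier hf hfc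
    (integrable_fourier_of_multiplier hα hf hfg)
  obtain ⟨q, K, hqc, hqK, hqF⟩ := exists_kernel_fourier_eq hα hj
  have hq := integrable_of_norm_le_inv_one_add_sq hqc hqK
  have hK0 : 0 ≤ K := by simpa using (norm_nonneg _).trans (hqK 0)
  have hK : ∀ x, ‖q x‖ ≤ K := fun x => by
    refine (hqK x).trans (mul_le_of_le_one_right hK0 (inv_le_one_of_one_le₀ ?_))
    nlinarith
  have hR : rieszConst α j ≠ 0 := by
    rw [rieszConst_eq]
    exact mul_ne_zero (mul_ne_zero (pow_ne_zero _ (by norm_num)) (by positivity))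
      (sinKernelTail_zero_pos h0 hj').ne'
  let W := cauchyMean fun t => ‖f t‖ + ‖g t‖
  let I : ℕ → ℝ → ℂ := fun k x => (-1 : ℂ) ^ k * ((2 * j).choose k : ℂ) *
    ∫ u in Ioi (1 : ℝ), f (x + ((j : ℝ) - (k : ℝ)) * u) / ((u ^ (1 + α) : ℝ) : ℂ)
  let s := (Finset.range (2 * j + 1)).erase j
  have hconv : ∀ x, ‖truncRiesz α j f 1 x‖ ≤ K * W x := fun x => by
    rw [truncRiesz_eq_convolution hα hf hfc hg hfg hj' hq hqc hK hqF one_pos]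
    have e : dilate q 1 = q := by ext x; simp [dilate]
    rw [e, convolution]
    have hWi := (integrable_mul_inv_one_add_sq (hf.norm.add hg.norm) x).const_mul K
    simp only [W, cauchyMean]
    rw [← integral_const_mul]
    refine norm_integral_le_of_norm_le hWi (Eventually.of_forall fun t => ?_)
    rw [ContinuousLinearMap.mul_apply', norm_mul]
    calc ‖g t‖ * ‖q (x - t)‖ ≤ (‖f t‖ + ‖g t‖) * (K * (1 + (x - t) ^ 2)⁻¹) :=
          mul_le_mul (by linarith [norm_nonneg (f t)]) (hqK _) (norm_nonneg _) (by positivity)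
      _ = K * ((‖f t‖ + ‖g t‖) * (1 + (x - t) ^ 2)⁻¹) := by ring
  have hside : ∀ k ∈ s, ∀ x, ‖I k x‖ ≤
      ((2 * j).choose k : ℝ) * (2 * |(j : ℝ) - k|) * W x := fun k hk x => by
    have hkj : k ≠ j := (Finset.mem_erase.1 hk).1
    have hm : 1 ≤ |(j : ℝ) - k| := by
      have : (1 : ℤ) ≤ |(j : ℤ) - k| := Int.one_le_abs (by omega)
      exact_mod_cast this
    have h1 := norm_integral_comp_add_mul_le hf hα hm x
    have h2 : cauchyMean (fun t => ‖f t‖) x ≤ W x := cauchyMean_mono hf.norm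
      (hf.norm.add hg.norm) (fun t => le_add_of_nonneg_right (norm_nonneg _)) x
    simp only [I, norm_mul, norm_pow, norm_neg, norm_one, one_pow, one_mul,
      Complex.norm_natCast]
    rw [mul_assoc]
    refine mul_le_mul_of_nonneg_left (h1.trans ?_) (by positivity)
    exact mul_le_mul_of_nonneg_left h2 (by positivity)
  have hcentre : ∀ x, I j x = (-1 : ℂ) ^ j * ((2 * j).choose j : ℂ) * (f x * (α⁻¹ : ℝ)) :=
    fun x => by
      simp only [I, sub_self, zero_mul, add_zero]
      congr 1
      have h1 : ∫ u in Ioi (1 : ℝ), (u ^ (1 + α))⁻¹ = α⁻¹ := by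
        have h2 : ∫ u in Ioi (1 : ℝ), u ^ (-(1 + α)) = α⁻¹ := by
          rw [integral_Ioi_rpow_of_lt (by linarith) one_pos, Real.one_rpow]
          rw [inv_eq_one_div, ← neg_div_neg_eq]
          ring_nf
        rw [← h2]
        refine setIntegral_congr_fun measurableSet_Ioi fun u hu => ?_
        rw [← Real.rpow_neg (zero_le_one.trans (le_of_lt hu))]
      rw [← h1, ← integral_complex_ofReal, ← integral_const_mul]
      simp_rw [Complex.ofReal_inv, div_eq_mul_inv]
  refine ⟨α * (|rieszConst α j| * K +
    ∑ k ∈ s, ((2 * j).choose k : ℝ) * (2 * |(j : ℝ) - k|)), by positivity, fun x => ?_⟩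
  have hsum : I j x = rieszConst α j * truncRiesz α j f 1 x - ∑ k ∈ s, I k x := by
    rw [truncRiesz_eq_sum hfc hM h0 one_pos j x, ← mul_assoc, ← Complex.ofReal_mul,
      mul_one_div_cancel hR, Complex.ofReal_one, one_mul, eq_sub_iff_add_eq]
    exact Finset.add_sum_erase (Finset.range (2 * j + 1)) (fun k => I k x)
      (Finset.mem_range.2 (by omega))
  have hlow : ‖f x‖ * α⁻¹ ≤ ‖I j x‖ := by
    rw [hcentre]
    simp only [norm_mul, norm_pow, norm_neg, norm_one, one_pow, one_mul, Complex.norm_natCast,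
      Complex.norm_real, Real.norm_of_nonneg (inv_pos.2 h0).le]
    refine le_mul_of_one_le_left (by positivity) ?_
    exact_mod_cast Nat.choose_pos (by omega)
  have hup : ‖I j x‖ ≤ (|rieszConst α j| * K +
      ∑ k ∈ s, ((2 * j).choose k : ℝ) * (2 * |(j : ℝ) - k|)) * W x := by
    rw [hsum, add_mul, Finset.sum_mul]
    refine (norm_sub_le _ _).trans (add_le_add ?_ (norm_sum_le_of_le _ fun k hk => hside k hk x))
    rw [norm_mul, Complex.norm_real, Real.norm_eq_abs, mul_assoc]
    exact mul_le_mul_of_nonneg_left (hconv x) (abs_nonneg _)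
  have h3 := hlow.trans hup
  rw [← div_eq_mul_inv, div_le_iff₀ h0] at h3
  refine h3.trans_eq ?_
  simp only [W]
  ring

/-- Poisson summation with step `h`, together with absolute convergence of the sampling series. -/
lemma summable_and_tsum_eq_tsum_fourier (hα : 1 < α) (hf : Integrable f) (hfc : Continuous f)
    (hg : Integrable g) (hfg : ∀ ξ, 𝓕 g ξ = (((2 * Real.pi * |ξ|) ^ α : ℝ) : ℂ) * 𝓕 f ξ)
    {h : ℝ} (hh : 0 < h) (hsum : Summable fun k : ℤ => 𝓕 f (h⁻¹ * k)) :
    Summable (fun k : ℤ => f (h * k)) ∧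
      h * ∑' k : ℤ, f (h * k) = ∑' k : ℤ, 𝓕 f (h⁻¹ * k) := by
  obtain ⟨C, hC0, hC⟩ := exists_norm_le_cauchyMean hα hf hfc hg hfg
  set F : ℝ → ℝ := fun t => ‖f t‖ + ‖g t‖ with hFdef
  have hF : Integrable F := hf.norm.add hg.norm
  have hF0 : ∀ t, 0 ≤ F t := fun t => by positivity
  have hS := summable_cauchyMean hF hF0 hh
  refine ⟨Summable.of_norm_bounded (hS.mul_left C) fun k => hC _, ?_⟩
  -- Poisson summation with unit step applies to `φ x = h * f (h * x)`.
  let φ : C(ℝ, ℂ) := ⟨dilate f h⁻¹, continuous_dilate hfc _⟩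
  have hφ : ∀ x, φ x = h * f (h * x) := fun x => by simp [φ, dilate]
  have hP := Real.tsum_eq_tsum_fourier (f := φ) (fun K => ?_) ?_ 0
  · have e1 : ∀ n : ℤ, 𝓕 (φ : ℝ → ℂ) n = 𝓕 f (h⁻¹ * n) := fun n =>
      fourier_dilate f (inv_pos.2 hh) n
    simp only [hφ, zero_add, tsum_mul_left, e1] at hP
    rw [hP]
    simp
  · obtain ⟨R, hR⟩ := K.isCompact.isBounded.subset_closedBall 0
    refine Summable.of_norm_bounded
      (hS.mul_left (h * (C * (2 * (1 + (h * R) ^ 2))))) fun n => ?_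
    rw [norm_norm, ContinuousMap.norm_le _ (mul_nonneg (by positivity) (cauchyMean_nonneg hF0 _))]
    intro x
    have hx : |(x : ℝ)| ≤ R := by simpa using hR x.2
    change ‖φ (x + n)‖ ≤ _
    rw [hφ, norm_mul, Complex.norm_real, Real.norm_of_nonneg hh.le, mul_assoc, mul_assoc]
    refine mul_le_mul_of_nonneg_left ((hC _).trans (mul_le_mul_of_nonneg_left ?_ hC0)) hh.le
    have e : h * ((x : ℝ) + n) = h * n + h * x := by ring
    rw [e]
    refine (cauchyMean_add_le hF hF0 _ _).trans ?_
    refine mul_le_mul_of_nonneg_right ?_ (cauchyMean_nonneg hF0 _)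
    rw [mul_pow, mul_pow]
    gcongr 2 * (1 + h ^ 2 * ?_)
    exact sq_le_sq' (by linarith [abs_le.1 hx]) (by linarith [abs_le.1 hx])
  · refine hsum.congr fun n => ?_
    exact (fourier_dilate f (inv_pos.2 hh) n).symm

end Multiplier

/-! ### The remainder of the trapezoidal rule -/

lemma fourierT_eq (f : ℝ → ℂ) (v : ℝ) :
    fourierT f v = ((1 / Real.sqrt (2 * Real.pi) : ℝ) : ℂ) * 𝓕 f (v / (2 * Real.pi)) := by
  rw [fourierT, Real.fourier_real_eq_integral_exp_smul]
  congr 2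
  ext u
  have e : ((-2 * Real.pi * u * (v / (2 * Real.pi)) : ℝ) : ℂ) * Complex.I =
      -(Complex.I * u * v) := by
    have : -2 * Real.pi * u * (v / (2 * Real.pi)) = -(u * v) := by
      field_simp
    rw [this]
    push_cast
    ring
  rw [e, smul_eq_mul, mul_comm]

lemma mem_fourierClass_iff {α : ℝ} {f : ℝ → ℂ} :
    f ∈ fourierClass (fun v : ℝ => ((|v| ^ α : ℝ) : ℂ)) ↔ Integrable f ∧ ∃ g : ℝ → ℂ,
      Integrable g ∧ ∀ ξ, 𝓕 g ξ = (((2 * Real.pi * |ξ|) ^ α : ℝ) : ℂ) * 𝓕 f ξ := by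
  have hs : ((1 / Real.sqrt (2 * Real.pi) : ℝ) : ℂ) ≠ 0 := by
    exact_mod_cast (by positivity : (1 / Real.sqrt (2 * Real.pi) : ℝ) ≠ 0)
  have hpi : 2 * Real.pi ≠ 0 := by positivity
  simp only [fourierClass, mem_ofPred_eq, fourierT_eq]
  refine and_congr_right fun _ => exists_congr fun g => and_congr_right fun _ => ?_
  constructor
  · intro h ξ
    have h1 := h (2 * Real.pi * ξ)
    rw [mul_div_cancel_left₀ _ hpi, abs_mul, abs_of_pos (by positivity : 0 < 2 * Real.pi),
      mul_left_comm] at h1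
    exact (mul_left_cancel₀ hs h1).symm
  · intro h v
    rw [h, abs_div, abs_of_pos (by positivity : 0 < 2 * Real.pi), mul_div_cancel₀ _ hpi]
    ring

lemma hasSum_int_abs_rpow_neg {α : ℝ} (hα : 1 < α) :
    HasSum (fun k : ℤ => |(k : ℝ)| ^ (-α)) (2 * (riemannZeta (α : ℂ)).re) := by
  have hs : Summable fun n : ℕ => (n : ℝ) ^ (-α) := Real.summable_nat_rpow.2 (by linarith)
  have hz : (riemannZeta (α : ℂ)).re = ∑' n : ℕ, (n : ℝ) ^ (-α) := by
    rw [zeta_eq_tsum_one_div_nat_cpow (by simpa using hα)]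
    have : ∀ n : ℕ, 1 / (n : ℂ) ^ (α : ℂ) = (((n : ℝ) ^ (-α) : ℝ) : ℂ) := fun n => by
      rw [Real.rpow_neg n.cast_nonneg, Complex.ofReal_inv, Complex.ofReal_cpow n.cast_nonneg,
        one_div, Complex.ofReal_natCast]
    simp_rw [this]
    rw [← Complex.ofReal_tsum, Complex.ofReal_re]
  have h1 : HasSum (fun n : ℕ => |((n : ℤ) : ℝ)| ^ (-α)) (riemannZeta (α : ℂ)).re := by
    rw [hz]
    simpa using hs.hasSum
  have h2 : HasSum (fun n : ℕ => |((-(n : ℤ) : ℤ) : ℝ)| ^ (-α)) (riemannZeta (α : ℂ)).re := by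
    simpa using h1
  have h3 := HasSum.of_nat_of_neg (f := fun k : ℤ => |(k : ℝ)| ^ (-α)) h1 h2
  simpa [Real.zero_rpow (by linarith : -α ≠ 0), two_mul] using h3

lemma bddAbove_integral_norm_forwardDiff {g : ℝ → ℂ} (hg : Integrable g) (r : ℕ) (δ : ℝ) :
    BddAbove {y : ℝ | ∃ t : ℝ, |t| ≤ δ ∧ y = ∫ x : ℝ, ‖forwardDiff r t g x‖} := by
  refine ⟨∑ j ∈ Finset.range (r + 1), (r.choose j : ℝ) * ∫ x, ‖g x‖, ?_⟩
  rintro _ ⟨t, -, rfl⟩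
  have hi : ∀ j : ℕ, Integrable fun x => (r.choose j : ℝ) * ‖g (x + j * t)‖ := fun j =>
    (hg.comp_add_right _).norm.const_mul _
  calc ∫ x, ‖forwardDiff r t g x‖
      ≤ ∫ x, ∑ j ∈ Finset.range (r + 1), (r.choose j : ℝ) * ‖g (x + j * t)‖ := by
        refine integral_mono (integrable_forwardDiff hg r t).norm
          (integrable_finsetSum _ fun j _ => hi j) fun x => ?_
        refine norm_sum_le_of_le _ fun j _ => ?_
        simp
    _ = ∑ j ∈ Finset.range (r + 1), (r.choose j : ℝ) * ∫ x, ‖g x‖ := by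
        rw [integral_finsetSum _ fun j _ => hi j]
        refine Finset.sum_congr rfl fun j _ => ?_
        rw [integral_const_mul, integral_add_right_eq_self (fun x => ‖g x‖)]

/-- At the frequency `k/h` the symbol `(e^{2πitξ} - 1)^r` of the difference of step `t = h/(2k)`
equals `(-2)^r`. -/
lemma norm_fourier_le_modulus {g : ℝ → ℂ} (hg : Integrable g) (r : ℕ) {h : ℝ} (hh : 0 < h)
    {k : ℤ} (hk : k ≠ 0) : ‖𝓕 g (h⁻¹ * k)‖ ≤ modulus r g (h / 2) / 2 ^ r := by
  have hk' : (k : ℝ) ≠ 0 := by exact_mod_cast hk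
  have hk1 : (1 : ℝ) ≤ |(k : ℝ)| := by exact_mod_cast Int.one_le_abs hk
  set t := h / (2 * k) with ht
  have htle : |t| ≤ h / 2 := by
    rw [ht, abs_div, abs_mul, abs_of_pos hh, abs_two]
    gcongr
    linarith
  have hexp : Complex.exp (2 * Real.pi * Complex.I * t * ((h⁻¹ * k : ℝ) : ℂ)) = -1 := by
    rw [← Complex.exp_pi_mul_I]
    congr 1
    have : t * (h⁻¹ * k) = 1 / 2 := by rw [ht]; field_simp
    have hc : (t : ℂ) * ((h⁻¹ * k : ℝ) : ℂ) = 1 / 2 := by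
      rw [← Complex.ofReal_mul, this]
      push_cast
      rfl
    linear_combination (2 * Real.pi * Complex.I) * hc
  have h1 := norm_fourier_le_integral (forwardDiff r t g) (h⁻¹ * k)
  rw [fourier_forwardDiff hg, hexp, norm_mul, norm_pow] at h1
  have h2 : ‖(-1 - 1 : ℂ)‖ = 2 := by norm_num
  rw [h2] at h1
  rw [le_div_iff₀ (by positivity), mul_comm]
  exact h1.trans (le_csSup (bddAbove_integral_norm_forwardDiff hg r _) ⟨t, htle, rfl⟩)

section Multiplier

variable {α : ℝ} {f g : ℝ → ℂ}

lemma norm_fourier_le_abs_rpow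
    (hfg : ∀ ξ, 𝓕 g ξ = (((2 * Real.pi * |ξ|) ^ α : ℝ) : ℂ) * 𝓕 f ξ) {h B : ℝ} (hh : 0 < h)
    {k : ℤ} (hk : k ≠ 0) (hB : ‖𝓕 g (h⁻¹ * k)‖ ≤ B) :
    ‖𝓕 f (h⁻¹ * k)‖ ≤ (h / (2 * Real.pi)) ^ α * B * |(k : ℝ)| ^ (-α) := by
  have hk' : (k : ℝ) ≠ 0 := by exact_mod_cast hk
  have h2 : 0 < 2 * Real.pi := by positivity
  rw [norm_fourier_eq_of_multiplier hfg (mul_ne_zero (inv_ne_zero hh.ne') hk')]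
  have e : (2 * Real.pi * |h⁻¹ * k|) ^ (-α) = (h / (2 * Real.pi)) ^ α * |(k : ℝ)| ^ (-α) := by
    rw [abs_mul, abs_of_pos (inv_pos.2 hh), ← mul_assoc, Real.mul_rpow (by positivity)
      (abs_nonneg _), Real.rpow_neg (by positivity), ← Real.inv_rpow (by positivity), mul_inv,
      inv_inv, div_eq_mul_inv, mul_comm h]
  rw [e, mul_right_comm]
  gcongr

lemma summable_fourier_of_multiplier (hα : 1 < α)
    (hfg : ∀ ξ, 𝓕 g ξ = (((2 * Real.pi * |ξ|) ^ α : ℝ) : ℂ) * 𝓕 f ξ) {h : ℝ} (hh : 0 < h) :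
    Summable fun k : ℤ => 𝓕 f (h⁻¹ * k) := by
  refine Summable.of_norm_bounded_eventually
    ((hasSum_int_abs_rpow_neg hα).summable.mul_left ((h / (2 * Real.pi)) ^ α * ∫ x, ‖g x‖)) ?_
  filter_upwards [(finite_singleton (0 : ℤ)).compl_mem_cofinite] with k hk
  exact norm_fourier_le_abs_rpow hfg hh hk (norm_fourier_le_integral g _)

lemma hasSum_ne_zero_abs_rpow_neg (hα : 1 < α) :
    HasSum (fun k : {k : ℤ // k ≠ 0} => |((k : ℤ) : ℝ)| ^ (-α))
      (2 * (riemannZeta (α : ℂ)).re) := by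
  refine (hasSum_subtype_iff_of_support_subset (s := {k : ℤ | k ≠ 0}) ?_).2
    (hasSum_int_abs_rpow_neg hα)
  rintro k hk rfl
  exact hk (by simp [Real.zero_rpow (by linarith : -α ≠ 0)])

lemma fourierT_mul_eq (f : ℝ → ℂ) {σ h : ℝ} (hh : h = 2 * Real.pi / σ) (k : ℤ) :
    fourierT f ((k : ℝ) * σ) =
      ((1 / Real.sqrt (2 * Real.pi) : ℝ) : ℂ) * 𝓕 f (h⁻¹ * k) := by
  rw [fourierT_eq, hh, inv_div]
  ring_nf

lemma remainder_eq (f : ℝ → ℂ) {σ h : ℝ} (hh : h = 2 * Real.pi / σ) :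
    remainder σ f = -∑' k : {k : ℤ // k ≠ 0}, 𝓕 f (h⁻¹ * ((k : ℤ) : ℝ)) := by
  have hs : Real.sqrt (2 * Real.pi) ≠ 0 := by positivity
  rw [remainder]
  simp_rw [fourierT_mul_eq f hh]
  rw [tsum_mul_left, ← mul_assoc, neg_mul, ← Complex.ofReal_mul, mul_one_div_cancel hs,
    Complex.ofReal_one, neg_one_mul]

/-- A uniform bound for `ĝ = |v|^α f̂` at the nonzero sampling frequencies bounds the remainder. -/
lemma norm_remainder_le (hα : 1 < α)
    (hfg : ∀ ξ, 𝓕 g ξ = (((2 * Real.pi * |ξ|) ^ α : ℝ) : ℂ) * 𝓕 f ξ) {σ h B : ℝ}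
    (hh0 : 0 < h) (hh : h = 2 * Real.pi / σ)
    (hB : ∀ k : ℤ, k ≠ 0 → ‖𝓕 g (h⁻¹ * k)‖ ≤ B) :
    ‖remainder σ f‖ ≤
      h ^ α * ((riemannZeta (α : ℂ)).re / (Real.pi ^ α * (2 : ℝ) ^ (α - 1))) * B := by
  rw [remainder_eq f hh, norm_neg]
  refine (tsum_of_norm_bounded ((hasSum_ne_zero_abs_rpow_neg hα).mul_left
    ((h / (2 * Real.pi)) ^ α * B)) fun k =>
      norm_fourier_le_abs_rpow hfg hh0 k.2 (hB k k.2)).trans_eq ?_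
  rw [Real.div_rpow hh0.le (by positivity), Real.mul_rpow zero_le_two Real.pi_pos.le,
    Real.rpow_sub_one two_ne_zero]
  field_simp

end Multiplier

end RieszQuadrature
end

theorem mainTheorem7 (α : ℝ) (hα : 1 < α) (f : ℝ → ℂ) (hf : Integrable f) (hfc : Continuous f) :
    (f ∈ RieszQuadrature.fourierClass (fun v : ℝ => ((|v| ^ α : ℝ) : ℂ)) ↔
      ∃ g : ℝ → ℂ, RieszQuadrature.IsStrongRieszDeriv α f g) ∧
    ∀ g : ℝ → ℂ, RieszQuadrature.IsStrongRieszDeriv α f g →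
      ∀ σ h : ℝ, 0 < σ → h = 2 * Real.pi / σ →
        Summable (fun k : ℤ => f (h * (k : ℝ))) ∧
        Summable (fun k : {k : ℤ // k ≠ 0} =>
          RieszQuadrature.fourierT f (((k : ℤ) : ℝ) * σ)) ∧
        (∫ t : ℝ, f t) = (h : ℂ) * ∑' k : ℤ, f (h * (k : ℝ))
          + RieszQuadrature.remainder σ f ∧
        (∀ r : ℕ, 1 ≤ r →
          ‖RieszQuadrature.remainder σ f‖ ≤
            h ^ α * ((riemannZeta (α : ℂ)).re / (Real.pi ^ α * (2 : ℝ) ^ ((r : ℝ) + α - 1))) *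
              RieszQuadrature.modulus r g (h / 2)) ∧
        ‖RieszQuadrature.remainder σ f‖ ≤
          h ^ α * ((riemannZeta (α : ℂ)).re / (Real.pi ^ α * (2 : ℝ) ^ (α - 1))) *
            ∫ x : ℝ, ‖g x‖ := by
  open RieszQuadrature FourierTransform in
  refine ⟨⟨fun hmem => ?_, fun ⟨g, hg⟩ => ?_⟩, fun g hg σ h hσ hh => ?_⟩
  · obtain ⟨-, g, hg, hfg⟩ := mem_fourierClass_iff.1 hmem
    -- The Fourier transform only sees the class of `g`, so a measurable representative will do.
    have hae := hg.1.ae_eq_mk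
    refine ⟨hg.1.mk g, isStrongRieszDeriv_of_fourier_eq hα hf hfc (hg.congr hae)
      hg.1.stronglyMeasurable_mk fun ξ => ?_⟩
    rw [← hfg ξ, Real.fourier_real_eq_integral_exp_smul, Real.fourier_real_eq_integral_exp_smul]
    refine integral_congr_ae ?_
    filter_upwards [hae] with x hx
    rw [hx]
  · exact mem_fourierClass_iff.2 ⟨hf, g, hg.2.1, hg.fourier_eq hfc⟩
  · have hfg := hg.fourier_eq hfc
    have hgi : Integrable g := hg.2.1
    have hh0 : 0 < h := by rw [hh]; positivity
    have hsum := summable_fourier_of_multiplier hα hfg hh0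
    obtain ⟨hS, hP⟩ := summable_and_tsum_eq_tsum_fourier hα hf hfc hgi hfg hh0 hsum
    refine ⟨hS, ?_, ?_, fun r _ => ?_, ?_⟩
    · simp_rw [fourierT_mul_eq f hh]
      exact (hsum.subtype {k : ℤ | k ≠ 0}).mul_left _
    · have h0 : 𝓕 f (h⁻¹ * ((0 : ℤ) : ℝ)) = ∫ t, f t := by
        simp [Real.fourier_real_eq_integral_exp_smul]
      have hsub : ∑' k : {k : ℤ // k ≠ 0}, 𝓕 f (h⁻¹ * ((k : ℤ) : ℝ)) =
          ∑' k : ℤ, if k = 0 then 0 else 𝓕 f (h⁻¹ * (k : ℝ)) := by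
        refine (tsum_subtype {k : ℤ | k ≠ 0} fun k : ℤ => 𝓕 f (h⁻¹ * (k : ℝ))).trans ?_
        refine tsum_congr fun k => ?_
        by_cases hk : k = 0 <;> simp [hk]
      rw [hP, remainder_eq f hh, hsub, hsum.tsum_eq_add_tsum_ite 0, h0]
      ring
    · refine (norm_remainder_le hα hfg hh0 hh fun k hk =>
        norm_fourier_le_modulus hgi r hh0 hk).trans_eq ?_
      have e : (2 : ℝ) ^ ((r : ℝ) + α - 1) = 2 ^ r * 2 ^ (α - 1) := by
        rw [add_sub_assoc, Real.rpow_add two_pos, Real.rpow_natCast]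
      rw [e]
      field_simp
    · exact norm_remainder_le hα hfg hh0 hh fun k _ => norm_fourier_le_integral g _
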